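/- Let $n\ge 1$ and $N\ge 1$ be integers and let $\alpha>-1$. Let $\mathbb B=\{z\in\mathbb C^n:|z|<1\}$ be the Euclidean unit ball, $\langle z,w\rangle=\sum_i z_i\overline{w_i}$, and let $dv_\alpha$ be the probability measure on $\mathbb B$ that is a constant multiple of $(1-|z|^2)^\alpha$ times Lebesgue measure. For $g\in L^\infty(\mathbb B)$ put $$P_\alpha g(z)=\int_{\mathbb B}\frac{g(w)}{(1-\langle z,w\rangle)^{n+1+\alpha}}\,dv_\alpha(w),\qquad z\in\mathbb B .$$ For $f$ holomorphic in $\mathbb B$ let $$\|f\|_{\tilde{\mathcal B},N}=\max_{|m|=N}\ \sup_{z\in\mathbb B}\,(1-|z|^2)^N\left|\frac{\partial^N f}{\partial z^m}(z)\right| ,$$ where $m$ runs over multi-indices in $\mathbb N_0^n$. Then $P_\alpha$ maps $L^\infty(\mathbb B)$ into the Bloch space of $\mathbb B$ (the holomorphic $f$ with $\sup_{z\in\mathbb B}(1-|z|^2)|\nabla f(z)|<\infty$, where $\nabla f=(\partial f/\partial z_1,\dots,\partial f/\partial z_n)$), and $$\|P_\alpha\|_{\tilde{\mathcal B},N}:=\sup_{\|g\|_\infty\le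 1}\|P_\alpha g\|_{\tilde{\mathcal B},N}=\frac{\Gamma(n+N+\alpha+1)\,\Gamma(N)}{\Gamma^2\!\left(\frac N2+\frac{n+\alpha+1}2\right)} .$$ In particular, for $N=1$ the norm is $\Gamma(n+\alpha+2)/\Gamma^2\!\left(\frac{n+\alpha+2}{2}\right)$, and for $N=n=1$, $\alpha=0$ it is $8/\pi$. -/

import Mathlib

open MeasureTheory Metric
open scoped ENNReal

noncomputable section

namespace BergmanBloch

/-- The space `ℂⁿ` with its Euclidean norm. -/
abbrev Cn (n : ℕ) : Type := EuclideanSpace ℂ (Fin n)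

/-- The (unnormalized) weighted measure `(1 - |z|²)^α dV(z)` on the unit ball of `ℂⁿ`, where `dV` is
Lebesgue measure. It is carried by the ball: the complement of the ball has measure zero. -/
def weightedVolume (n : ℕ) (α : ℝ) : Measure (Cn n) :=
  (volume.restrict (ball (0 : Cn n) 1)).withDensity
    (fun z => ENNReal.ofReal ((1 - ‖z‖ ^ 2) ^ α))

/-- The probability measure `dv_α(z) = c_α (1 - |z|²)^α dv(z)` on the unit ball of `ℂⁿ`: the multiple
of `(1 - |z|²)^α dV(z)` of total mass `1`. -/
def weightedMeasure (n : ℕ) (α : ℝ) : Measure (Cn n) :=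
  (weightedVolume n α Set.univ)⁻¹ • weightedVolume n α

/-- The weighted Bergman kernel `(1 - ⟨z, w⟩)^{-(n+1+α)}` (principal branch; `1 - ⟨z, w⟩` has positive
real part for `z, w` in the ball). Here `⟨z, w⟩ = ∑ z_i * conj w_i`, which is `inner ℂ w z` in
Mathlib, where the first argument is the conjugate-linear one. -/
def kernel (n : ℕ) (α : ℝ) (z w : Cn n) : ℂ :=
  1 / (1 - inner ℂ w z) ^ (((n : ℝ) + 1 + α : ℝ) : ℂ)

/-- The Bergman projection `P_α g (z) = ∫ K_α(z, w) g(w) dv_α(w)`. -/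
def bergmanProjection (n : ℕ) (α : ℝ) (g : Cn n → ℂ) (z : Cn n) : ℂ :=
  ∫ w, kernel n α z w * g w ∂(weightedMeasure n α)

/-- The complex partial derivative `∂f/∂z_i`. -/
def partialDeriv {n : ℕ} (i : Fin n) (f : Cn n → ℂ) (z : Cn n) : ℂ :=
  lineDeriv ℂ f z (EuclideanSpace.single i (1 : ℂ))

/-- The mixed partial derivative `∂^{|m|} f / ∂z^m = ∂₁^{m₁} ⋯ ∂ₙ^{mₙ} f` for a multi-index `m`. -/
def multiDeriv {n : ℕ} (m : Fin n → ℕ) (f : Cn n → ℂ) : Cn n → ℂ :=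
  (List.finRange n).foldr (fun i F => (partialDeriv i)^[m i] F) f

/-- The complex gradient `∇f = (∂f/∂z_1, …, ∂f/∂z_n)`. -/
def complexGradient {n : ℕ} (f : Cn n → ℂ) (z : Cn n) : Cn n :=
  WithLp.toLp 2 (fun i => partialDeriv i f z)

/-- Membership in the Bloch space of the unit ball: `f` is holomorphic in the ball and
`sup_{|z| < 1} (1 - |z|²) |∇f(z)|` is finite. -/
def IsBloch {n : ℕ} (f : Cn n → ℂ) : Prop :=
  DifferentiableOn ℂ f (ball (0 : Cn n) 1) ∧
    ∃ C : ℝ, ∀ z ∈ ball (0 : Cn n) 1, (1 - ‖z‖ ^ 2) * ‖complexGradient f z‖ ≤ C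

/-- The seminorm `max_{|m| = N} sup_{|z| < 1} (1 - |z|²)^N |∂^N f/∂z^m (z)|`, as an extended
nonnegative number. -/
def blochSeminorm {n : ℕ} (N : ℕ) (f : Cn n → ℂ) : ℝ≥0∞ :=
  ⨆ (m : Fin n → ℕ) (_ : ∑ i, m i = N) (z : Cn n) (_ : z ∈ ball (0 : Cn n) 1),
    ENNReal.ofReal ((1 - ‖z‖ ^ 2) ^ N * ‖multiDeriv m f z‖)

/-- The norm `sup_{‖g‖_∞ ≤ 1} ‖P_α g‖` of the Bergman projection on `L^∞` of the ball, with the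
seminorm of order `N` on the target, as an extended nonnegative number. -/
def bergmanNorm (n : ℕ) (α : ℝ) (N : ℕ) : ℝ≥0∞ :=
  ⨆ (g : Lp ℂ ∞ (weightedMeasure n α)) (_ : ‖g‖ ≤ 1),
    blochSeminorm N (bergmanProjection n α g)

end BergmanBloch

end

noncomputable section

namespace BergmanBloch
open Filter Topology

/-! Put s = n + 1 + α. Differentiating under the integral, ∂^m P_α g(z) with |m| = N equals
Γ(s+N)/Γ(s) times the integral of conj(w)^m g(w) (1 - ⟨z,w⟩)^(-(s+N)) against dv_α
(`multiDeriv_bergmanProjection`). On the ball |w^m| ≤ 1, so everything rests on the sharp size of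
(1-|z|²)^N ∫ |1 - ⟨z,w⟩|^(-(s+N)) dv_α(w).

By unitary invariance z may be taken to be r e₁ with r = |z|. The integrand then depends only on the
first coordinate of w, whose law is the normalized measure (1-|ζ|²)^(s-2) dA on the disc
(`lintegral_weightedMeasure_succ`). The disc involution φ_r turns (1-r²)^N ∫ |1-rζ|^(-(s+N)) into ∫
|1-rζ|^(N-s) (`lintegral_comp_discInvolution`). By Parseval this is a power series in r² with
nonnegative coefficients, so it increases to its value at r = 1, which polar coordinates centred at
1 express through Gamma functions (`lintegral_norm_one_sub_rpow`). This gives the upper bound.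

For the lower bound take z = r e₁, m = N e₁ and g of modulus at most 1 cancelling the phase of the
integrand. The only loss is the factor |w₁|^N, which the involution turns into |φ_r(ζ)|^N. This
tends to 1 pointwise as r → 1, and Fatou's lemma recovers the full constant. -/

/-! ### Beta, Gaussian and cosine integrals -/

theorem lintegral_comp_smul_addHaar {E : Type*} [NormedAddCommGroup E] [NormedSpace ℝ E]
    [MeasurableSpace E] [BorelSpace E] [FiniteDimensional ℝ E] (μ : Measure E)
    [μ.IsAddHaarMeasure] {r : ℝ} (hr : 0 < r) (f : E → ℝ≥0∞) :
    ∫⁻ x, f x ∂μ = ENNReal.ofReal (r ^ Module.finrank ℝ E) * ∫⁻ x, f (r • x) ∂μ := by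
  have h1 : ∫⁻ x, f (r • x) ∂μ = ENNReal.ofReal (r ^ Module.finrank ℝ E)⁻¹ * ∫⁻ x, f x ∂μ := by
    have h := (Homeomorph.smulOfNeZero r hr.ne').toMeasurableEquiv.measurableEmbedding.lintegral_map
      (μ := μ) f
    have h2 := Measure.map_addHaar_smul μ hr.ne'
    change Measure.map (Homeomorph.smulOfNeZero r hr.ne').toMeasurableEquiv μ = _ at h2
    rw [h2, lintegral_smul_measure, abs_of_pos (by positivity)] at h
    exact h.symm
  rw [h1, ← mul_assoc, ← ENNReal.ofReal_mul (by positivity), mul_inv_cancel₀ (by positivity)]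
  simp

theorem lintegral_rpow_mul_sub_rpow {p q a : ℝ} (hp : 0 < p) (hq : 0 < q) (ha : 0 < a) :
    ∫⁻ x in Set.Ioo 0 a, ENNReal.ofReal (x ^ (p - 1) * (a - x) ^ (q - 1)) =
      ENNReal.ofReal (a ^ (p + q - 1) * ProbabilityTheory.beta p q) := by
  have hB := ProbabilityTheory.beta_pos hp hq
  have h1 : ∫⁻ x in Set.Ioo (0 : ℝ) 1, ENNReal.ofReal (x ^ (p - 1) * (1 - x) ^ (q - 1)) =
      ENNReal.ofReal (ProbabilityTheory.beta p q) := by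
    have h := ProbabilityTheory.lintegral_betaPDF_eq_one hp hq
    rw [ProbabilityTheory.lintegral_betaPDF] at h
    simp_rw [mul_assoc] at h
    have h2 : ∀ x : ℝ, ENNReal.ofReal (1 / ProbabilityTheory.beta p q *
        (x ^ (p - 1) * (1 - x) ^ (q - 1))) = ENNReal.ofReal (1 / ProbabilityTheory.beta p q) *
        ENNReal.ofReal (x ^ (p - 1) * (1 - x) ^ (q - 1)) :=
      fun x => ENNReal.ofReal_mul (by positivity)
    simp_rw [h2] at h
    rw [lintegral_const_mul _ (by fun_prop)] at h
    have h3 := congrArg (fun t => ENNReal.ofReal (ProbabilityTheory.beta p q) * t) h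
    simp only [← mul_assoc, mul_one] at h3
    rw [← ENNReal.ofReal_mul hB.le, mul_one_div_cancel hB.ne'] at h3
    simpa using h3
  rw [← lintegral_indicator measurableSet_Ioo, lintegral_comp_smul_addHaar volume ha,
    Module.finrank_self, pow_one]
  have h2 : ∀ x : ℝ, (Set.Ioo 0 a).indicator
      (fun x => ENNReal.ofReal (x ^ (p - 1) * (a - x) ^ (q - 1))) (a • x) =
      ENNReal.ofReal (a ^ (p + q - 2)) * (Set.Ioo 0 1).indicator
        (fun x => ENNReal.ofReal (x ^ (p - 1) * (1 - x) ^ (q - 1))) x := by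
    intro x
    by_cases hx : x ∈ Set.Ioo (0 : ℝ) 1
    · have hx' : a • x ∈ Set.Ioo 0 a := by
        rw [smul_eq_mul]
        exact ⟨mul_pos ha hx.1, by nlinarith [hx.2]⟩
      rw [Set.indicator_of_mem hx, Set.indicator_of_mem hx', ← ENNReal.ofReal_mul (by positivity),
        smul_eq_mul, show a - a * x = a * (1 - x) by ring, Real.mul_rpow ha.le hx.1.le,
        Real.mul_rpow ha.le (by linarith [hx.2]),
        show p + q - 2 = (p - 1) + (q - 1) by ring, Real.rpow_add ha]
      congr 1; ring
    · have hx' : a • x ∉ Set.Ioo 0 a := by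
        rw [smul_eq_mul]
        rintro ⟨h1, h2⟩
        exact hx ⟨by nlinarith, by nlinarith⟩
      rw [Set.indicator_of_notMem hx, Set.indicator_of_notMem hx', mul_zero]
  simp_rw [h2]
  rw [lintegral_const_mul _ (Measurable.indicator (by fun_prop) measurableSet_Ioo),
    lintegral_indicator measurableSet_Ioo, h1, ← ENNReal.ofReal_mul (by positivity),
    ← ENNReal.ofReal_mul (by positivity), ← mul_assoc,
    show p + q - 1 = 1 + (p + q - 2) by ring, Real.rpow_add ha, Real.rpow_one]

theorem lintegral_rpow_mul_exp_neg_sq {p : ℝ} (hp : -1 < p) :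
    ∫⁻ x in Set.Ioi (0 : ℝ), ENNReal.ofReal (x ^ p * Real.exp (-x ^ 2)) =
      ENNReal.ofReal (1 / 2 * Real.Gamma ((p + 1) / 2)) := by
  have h := integral_rpow_mul_exp_neg_rpow (p := 2) (q := p) (by norm_num) hp
  have hi := integrableOn_rpow_mul_exp_neg_rpow (p := 2) (s := p) hp (by norm_num)
  simp only [Real.rpow_two] at h hi
  rw [← h, ofReal_integral_eq_lintegral_ofReal hi]
  filter_upwards [ae_restrict_mem measurableSet_Ioi] with x hx
  have : (0 : ℝ) < x := hx
  positivity

theorem lintegral_exp_neg_sq :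
    ∫⁻ x : ℝ, ENNReal.ofReal (Real.exp (-x ^ 2)) = ENNReal.ofReal (√Real.pi) := by
  have h := integral_gaussian 1
  have hi := integrable_exp_neg_mul_sq (b := 1) one_pos
  simp only [neg_mul, one_mul, div_one] at h hi
  rw [← h, ofReal_integral_eq_lintegral_ofReal hi]
  filter_upwards with x
  positivity

theorem lintegral_polarCoord_target (F : ℝ → ℝ → ℝ≥0∞) (hF : Measurable (Function.uncurry F)) :
    ∫⁻ p in polarCoord.target, F p.1 p.2 =
      ∫⁻ θ in Set.Ioo (-Real.pi) Real.pi, ∫⁻ ρ in Set.Ioi 0, F ρ θ := by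
  rw [polarCoord_target, Measure.volume_eq_prod, ← Measure.prod_restrict,
    lintegral_prod_symm _ (by exact hF.aemeasurable)]

/-- The integral of x^p exp(-x²-y²) over the half-plane x > 0 is computed twice: in Cartesian
coordinates it is a product of Gaussian integrals, and in polar coordinates the unknown angular
integral times a radial Gamma integral. -/
theorem lintegral_cos_rpow {p : ℝ} (hp : -1 < p) :
    ∫⁻ θ in Set.Ioo (-Real.pi) Real.pi,
        (if 0 < Real.cos θ then ENNReal.ofReal (Real.cos θ ^ p) else 0) =
      ENNReal.ofReal (√Real.pi * Real.Gamma ((p + 1) / 2) / Real.Gamma (p / 2 + 1)) := by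
  set X := ∫⁻ θ in Set.Ioo (-Real.pi) Real.pi,
        (if 0 < Real.cos θ then ENNReal.ofReal (Real.cos θ ^ p) else 0) with hX
  have hm : Measurable fun θ : ℝ => if 0 < Real.cos θ then ENNReal.ofReal (Real.cos θ ^ p) else 0 :=
    Measurable.ite (measurableSet_lt measurable_const (by fun_prop)) (by fun_prop) measurable_const
  have hG : 0 < Real.Gamma (p / 2 + 1) := Real.Gamma_pos_of_pos (by linarith)
  let f : ℝ × ℝ → ℝ≥0∞ := fun z =>
    (Set.Ioi 0).indicator (fun x : ℝ => ENNReal.ofReal (x ^ p * Real.exp (-x ^ 2))) z.1 *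
      ENNReal.ofReal (Real.exp (-z.2 ^ 2))
  have h1 : ∫⁻ z, f z =
      ENNReal.ofReal (1 / 2 * Real.Gamma ((p + 1) / 2)) * ENNReal.ofReal (√Real.pi) := by
    have hm1 : Measurable ((Set.Ioi 0).indicator
        (fun x : ℝ => ENNReal.ofReal (x ^ p * Real.exp (-x ^ 2)))) :=
      Measurable.indicator (by fun_prop) measurableSet_Ioi
    have hm2 : Measurable fun x : ℝ => ENNReal.ofReal (Real.exp (-x ^ 2)) := by fun_prop
    rw [Measure.volume_eq_prod, lintegral_prod_mul hm1.aemeasurable hm2.aemeasurable,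
      lintegral_indicator measurableSet_Ioi, lintegral_rpow_mul_exp_neg_sq hp,
      lintegral_exp_neg_sq]
  have h2 : ∫⁻ z, f z = X * ENNReal.ofReal (1 / 2 * Real.Gamma (p / 2 + 1)) := by
    rw [← lintegral_comp_polarCoord_symm]
    rw [setLIntegral_congr_fun (g := fun z : ℝ × ℝ =>
      ENNReal.ofReal (z.1 ^ (p + 1) * Real.exp (-z.1 ^ 2)) *
        (if 0 < Real.cos z.2 then ENNReal.ofReal (Real.cos z.2 ^ p) else 0))
      polarCoord.open_target.measurableSet]
    · rw [lintegral_polarCoord_target (fun ρ θ => ENNReal.ofReal (ρ ^ (p + 1) *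
        Real.exp (-ρ ^ 2)) * (if 0 < Real.cos θ then ENNReal.ofReal (Real.cos θ ^ p) else 0))]
      · rw [hX, ← lintegral_mul_const _ hm]
        refine lintegral_congr fun θ => ?_
        rw [lintegral_mul_const _ (by fun_prop), lintegral_rpow_mul_exp_neg_sq (by linarith),
          mul_comm]
        congr 4; ring
      · exact Measurable.mul (by fun_prop) (hm.comp measurable_snd)
    · rintro ⟨ρ, θ⟩ ⟨hρ, hθ⟩
      have hρ : 0 < ρ := hρ
      simp only [polarCoord_symm_apply, f, smul_eq_mul]
      by_cases hc : 0 < Real.cos θ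
      · rw [Set.indicator_of_mem (show ρ * Real.cos θ ∈ Set.Ioi 0 from mul_pos hρ hc), if_pos hc,
          ← ENNReal.ofReal_mul (by positivity), ← ENNReal.ofReal_mul (by positivity),
          ← ENNReal.ofReal_mul (by positivity), Real.mul_rpow hρ.le hc.le,
          Real.rpow_add hρ, Real.rpow_one]
        have : Real.exp (-ρ ^ 2) =
            Real.exp (-(ρ * Real.cos θ) ^ 2) * Real.exp (-(ρ * Real.sin θ) ^ 2) := by
          rw [← Real.exp_add]
          congr 1
          linear_combination ρ ^ 2 * Real.sin_sq_add_cos_sq θ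
        rw [this]
        congr 1; ring
      · rw [Set.indicator_of_notMem, if_neg hc]
        · simp
        · simp only [Set.mem_Ioi, not_lt]
          exact mul_nonpos_of_nonneg_of_nonpos hρ.le (not_lt.1 hc)
  rw [h1] at h2
  have h3 := congrArg (fun t => t * ENNReal.ofReal (1 / 2 * Real.Gamma (p / 2 + 1))⁻¹) h2
  have hG' : 0 < Real.Gamma ((p + 1) / 2) := Real.Gamma_pos_of_pos (by linarith)
  rw [mul_assoc X, ← ENNReal.ofReal_mul (by positivity : 0 ≤ 1 / 2 * Real.Gamma (p / 2 + 1)),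
    mul_inv_cancel₀ (by positivity),
    ENNReal.ofReal_one, mul_one] at h3
  rw [← h3, ← ENNReal.ofReal_mul (by positivity), ← ENNReal.ofReal_mul (by positivity)]
  congr 1
  field_simp

/-! ### The extremal integral over the disc -/

/-- The weight `(1 - |η|²)^(s-2)` times Lebesgue measure on the unit disc. -/
def discMeasure (s : ℝ) : Measure ℂ :=
  (volume.restrict (ball (0 : ℂ) 1)).withDensity (fun z => ENNReal.ofReal ((1 - ‖z‖ ^ 2) ^ (s - 2)))

theorem lintegral_discMeasure (s : ℝ) (f : ℂ → ℝ≥0∞) :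
    ∫⁻ z, f z ∂(discMeasure s) =
      ∫⁻ z in ball (0 : ℂ) 1, ENNReal.ofReal ((1 - ‖z‖ ^ 2) ^ (s - 2)) * f z := by
  rw [discMeasure, lintegral_withDensity_eq_lintegral_mul_non_measurable _ (by fun_prop)]
  · rfl
  · filter_upwards with x using ENNReal.ofReal_lt_top

/-- Legendre's duplication formula at (p+s-1)/2 absorbs the power of 2 and one factor √π. -/
theorem beta_mul_cos_integral {p s : ℝ} (hp : 0 < p) (hs : 1 < s) :
    2 ^ (p + s - 2) * ProbabilityTheory.beta p (s - 1) *
      (√Real.pi * Real.Gamma ((p + s - 2 + 1) / 2) / Real.Gamma ((p + s - 2) / 2 + 1)) =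
    Real.pi * Real.Gamma p * Real.Gamma (s - 1) / Real.Gamma ((p + s) / 2) ^ 2 := by
  have h := Real.Gamma_mul_Gamma_add_half ((p + s - 1) / 2)
  rw [show (p + s - 1) / 2 + 1 / 2 = (p + s) / 2 by ring,
    show 2 * ((p + s - 1) / 2) = p + s - 1 by ring] at h
  rw [ProbabilityTheory.beta, show (p + s - 2) / 2 + 1 = (p + s) / 2 by ring,
    show p + s - 2 + 1 = p + s - 1 by ring, show p + (s - 1) = p + s - 1 by ring]
  have h1 : 0 < Real.Gamma (p + s - 1) := Real.Gamma_pos_of_pos (by linarith)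
  have h2 : 0 < Real.Gamma ((p + s) / 2) := Real.Gamma_pos_of_pos (by linarith)
  have h3 : (2 : ℝ) ^ (p + s - 2) * 2 ^ (1 - (p + s - 1)) = 1 := by
    rw [← Real.rpow_add two_pos]; ring_nf; simp
  have h4 : √Real.pi * √Real.pi = Real.pi := Real.mul_self_sqrt Real.pi_pos.le
  rw [mul_div_assoc' ((2 : ℝ) ^ (p + s - 2)), div_mul_div_comm, div_eq_div_iff (by positivity)
    (by positivity)]
  linear_combination (2 ^ (p + s - 2) * Real.Gamma p * Real.Gamma (s - 1) * √Real.pi *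
    Real.Gamma ((p + s) / 2)) * h + (Real.Gamma p * Real.Gamma (s - 1) * √Real.pi * √Real.pi *
    Real.Gamma ((p + s) / 2) * Real.Gamma (p + s - 1)) * h3 + (Real.Gamma p * Real.Gamma (s - 1) *
    Real.Gamma ((p + s) / 2) * Real.Gamma (p + s - 1)) * h4

/-- Write z = 1 - ρe^(iθ). Then 1 - |z|² = ρ(2cos θ - ρ), so the disc is 0 < ρ < 2cos θ; the radial
integral is a Beta integral on an interval of length 2cos θ, and a power of cos θ is left for the
angle. -/
theorem lintegral_norm_one_sub_rpow {p s : ℝ} (hp : 0 < p) (hs : 1 < s) :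
    ∫⁻ z, ENNReal.ofReal (‖1 - z‖ ^ (p - s)) ∂(discMeasure s) =
      ENNReal.ofReal
        (Real.pi * Real.Gamma p * Real.Gamma (s - 1) / Real.Gamma ((p + s) / 2) ^ 2) := by
  have hB := ProbabilityTheory.beta_pos hp (sub_pos.2 hs)
  have hm : Measurable fun θ : ℝ =>
      if 0 < Real.cos θ then ENNReal.ofReal (Real.cos θ ^ (p + s - 2)) else 0 :=
    Measurable.ite (measurableSet_lt measurable_const (by fun_prop)) (by fun_prop) measurable_const
  rw [lintegral_discMeasure, ← lintegral_indicator measurableSet_ball,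
    ← lintegral_sub_left_eq_self _ (1 : ℂ), ← Complex.lintegral_comp_polarCoord_symm]
  let F : ℝ → ℝ → ℝ≥0∞ := fun ρ θ => (Set.Ioo 0 (2 * Real.cos θ)).indicator
    (fun ρ => ENNReal.ofReal (ρ ^ (p - 1) * (2 * Real.cos θ - ρ) ^ (s - 1 - 1))) ρ
  have hF : Measurable (Function.uncurry F) := by
    have : Function.uncurry F = {z : ℝ × ℝ | 0 < z.1 ∧ z.1 < 2 * Real.cos z.2}.indicator
      (fun z => ENNReal.ofReal (z.1 ^ (p - 1) * (2 * Real.cos z.2 - z.1) ^ (s - 1 - 1))) := by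
      ext ⟨ρ, θ⟩
      simp [F, Set.indicator]
    rw [this]
    refine Measurable.indicator (by fun_prop) ?_
    exact (measurableSet_lt measurable_const measurable_fst).inter
      (measurableSet_lt measurable_fst (by fun_prop))
  rw [setLIntegral_congr_fun (g := fun z : ℝ × ℝ => F z.1 z.2)
      polarCoord.open_target.measurableSet]
  · rw [lintegral_polarCoord_target F hF, ← beta_mul_cos_integral hp hs,
      ENNReal.ofReal_mul (by positivity), ← lintegral_cos_rpow (by linarith),
      ← lintegral_const_mul _ hm]
    refine lintegral_congr fun θ => ?_
    have h0 : ∫⁻ ρ in Set.Ioi 0, F ρ θ = ∫⁻ ρ in Set.Ioo 0 (2 * Real.cos θ),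
        ENNReal.ofReal (ρ ^ (p - 1) * (2 * Real.cos θ - ρ) ^ (s - 1 - 1)) := by
      simp only [F]
      rw [lintegral_indicator measurableSet_Ioo, Measure.restrict_restrict measurableSet_Ioo,
        Set.inter_eq_left.2 Set.Ioo_subset_Ioi_self]
    rw [h0]
    by_cases hc : 0 < Real.cos θ
    · rw [lintegral_rpow_mul_sub_rpow hp (by linarith) (by positivity), if_pos hc,
        ← ENNReal.ofReal_mul (by positivity), Real.mul_rpow (by positivity) hc.le,
        show p + (s - 1) - 1 = p + s - 2 by ring]
      congr 1; ring
    · rw [Set.Ioo_eq_empty (by linarith [not_lt.1 hc]), if_neg hc]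
      simp
  · rintro ⟨ρ, θ⟩ ⟨hρ, hθ⟩
    have hρ : 0 < ρ := hρ
    simp only [Complex.polarCoord_symm_apply, smul_eq_mul, F]
    set w : ℂ := (ρ : ℂ) * (Real.cos θ + Real.sin θ * Complex.I) with hw
    have hre : w.re = ρ * Real.cos θ := by
      simp [hw, Complex.cos_ofReal_im, Complex.sin_ofReal_im, Complex.cos_ofReal_re]
    have him : w.im = ρ * Real.sin θ := by
      simp [hw, Complex.cos_ofReal_im, Complex.sin_ofReal_im, Complex.sin_ofReal_re]
    have hn : ‖w‖ = ρ := by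
      have := Complex.norm_polarCoord_symm (ρ, θ)
      rwa [Complex.polarCoord_symm_apply, abs_of_pos hρ] at this
    have hn1 : 1 - ‖1 - w‖ ^ 2 = ρ * (2 * Real.cos θ - ρ) := by
      rw [← Complex.normSq_eq_norm_sq, Complex.normSq_apply]
      simp only [Complex.sub_re, Complex.one_re, Complex.sub_im, Complex.one_im, hre, him]
      linear_combination (-ρ ^ 2) * Real.sin_sq_add_cos_sq θ
    by_cases hc : ρ < 2 * Real.cos θ
    · have hb : 1 - w ∈ ball (0 : ℂ) 1 := by
        rw [mem_ball_zero_iff]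
        have : 0 < ρ * (2 * Real.cos θ - ρ) := mul_pos hρ (by linarith)
        nlinarith [norm_nonneg (1 - w)]
      rw [Set.indicator_of_mem hb, Set.indicator_of_mem (show ρ ∈ Set.Ioo 0 _ from ⟨hρ, hc⟩), hn1,
        sub_sub_cancel, hn,
        ← ENNReal.ofReal_mul (Real.rpow_nonneg (mul_nonneg hρ.le (by linarith)) _),
        ← ENNReal.ofReal_mul hρ.le, Real.mul_rpow hρ.le (by linarith),
        show s - 1 - 1 = s - 2 by ring, show p - 1 = 1 + (s - 2) + (p - s) by ring,
        Real.rpow_add hρ, Real.rpow_add hρ, Real.rpow_one]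
      congr 1; ring
    · have hb : 1 - w ∉ ball (0 : ℂ) 1 := by
        rw [mem_ball_zero_iff]
        intro h
        have : 0 < ρ * (2 * Real.cos θ - ρ) := by
          rw [← hn1]; nlinarith [norm_nonneg (1 - w)]
        exact hc (by linarith [(mul_pos_iff_of_pos_left hρ).1 this])
      rw [Set.indicator_of_notMem hb, Set.indicator_of_notMem (fun h => hc h.2), mul_zero]

/-! ### Change of variables by a disc automorphism -/

/-- Multiplication by a complex number c has real determinant equal to the field norm |c|². -/
theorem lintegral_image_eq_lintegral_norm_deriv_sq_mul {t : Set ℂ} (ht : MeasurableSet t)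
    {f f' : ℂ → ℂ} (hf : ∀ x ∈ t, HasDerivAt f (f' x) x) (hinj : Set.InjOn f t)
    (g : ℂ → ℝ≥0∞) :
    ∫⁻ x in f '' t, g x = ∫⁻ x in t, ENNReal.ofReal (‖f' x‖ ^ 2) * g (f x) := by
  have h := lintegral_image_eq_lintegral_abs_det_fderiv_mul volume ht
    (f' := fun x => (ContinuousLinearMap.toSpanSingleton ℂ (f' x)).restrictScalars ℝ)
    (fun x hx => ((hf x hx).hasFDerivAt.restrictScalars ℝ).hasFDerivWithinAt) hinj g
  rw [h]
  refine setLIntegral_congr_fun ht fun x hx => ?_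
  have hdet : ((ContinuousLinearMap.toSpanSingleton ℂ (f' x)).restrictScalars ℝ).det =
      Algebra.norm ℝ (f' x) := by
    rw [Algebra.norm_apply]
    change LinearMap.det _ = LinearMap.det _
    congr 1
    ext y
    simp [mul_comm]
  rw [hdet, Algebra.norm_complex_apply, Complex.normSq_eq_norm_sq, abs_of_nonneg (by positivity)]

theorem one_sub_ofReal_mul_ne_zero {r : ℝ} (hr0 : 0 ≤ r) (hr1 : r ≤ 1) {z : ℂ}
    (hz : z ∈ ball (0 : ℂ) 1) : 1 - (r : ℂ) * z ≠ 0 := by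
  rw [mem_ball_zero_iff] at hz
  intro h
  have : ‖(r : ℂ) * z‖ = 1 := by rw [← sub_eq_zero.1 h]; simp
  rw [norm_mul, Complex.norm_real, Real.norm_of_nonneg hr0] at this
  nlinarith [norm_nonneg z]

/-- The involutive automorphism of the disc exchanging `0` and `r`. -/
def discInvolution (r : ℝ) (z : ℂ) : ℂ := (r - z) / (1 - r * z)

theorem one_sub_norm_discInvolution_sq {r : ℝ} (hr0 : 0 ≤ r) (hr1 : r ≤ 1) {z : ℂ}
    (hz : z ∈ ball (0 : ℂ) 1) :
    1 - ‖discInvolution r z‖ ^ 2 = (1 - r ^ 2) * (1 - ‖z‖ ^ 2) / ‖1 - r * z‖ ^ 2 := by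
  have h0 := norm_pos_iff.2 (one_sub_ofReal_mul_ne_zero hr0 hr1 hz)
  rw [discInvolution, norm_div, div_pow, eq_div_iff (by positivity), sub_mul,
    div_mul_cancel₀ _ (by positivity)]
  simp only [← Complex.normSq_eq_norm_sq, Complex.normSq_apply]
  simp
  ring

theorem discInvolution_mem_ball {r : ℝ} (hr0 : 0 ≤ r) (hr1 : r < 1) {z : ℂ}
    (hz : z ∈ ball (0 : ℂ) 1) : discInvolution r z ∈ ball (0 : ℂ) 1 := by
  have h0 := norm_pos_iff.2 (one_sub_ofReal_mul_ne_zero hr0 hr1.le hz)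
  have h := one_sub_norm_discInvolution_sq hr0 hr1.le hz
  rw [mem_ball_zero_iff] at hz ⊢
  have h1 : 0 < 1 - r ^ 2 := by nlinarith
  have h2 : 0 < 1 - ‖z‖ ^ 2 := by nlinarith [norm_nonneg z]
  have : 0 < 1 - ‖discInvolution r z‖ ^ 2 := by rw [h]; positivity
  nlinarith [norm_nonneg (discInvolution r z)]

theorem one_sub_mul_discInvolution {r : ℝ} (hr0 : 0 ≤ r) (hr1 : r ≤ 1) {z : ℂ}
    (hz : z ∈ ball (0 : ℂ) 1) :
    1 - r * discInvolution r z = ((1 - r ^ 2 : ℝ) : ℂ) / (1 - r * z) := by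
  have h0 := one_sub_ofReal_mul_ne_zero hr0 hr1 hz
  rw [discInvolution, eq_div_iff h0, sub_mul, mul_assoc, div_mul_cancel₀ _ h0]
  push_cast
  ring

theorem discInvolution_discInvolution {r : ℝ} (hr0 : 0 ≤ r) (hr1 : r < 1) {z : ℂ}
    (hz : z ∈ ball (0 : ℂ) 1) : discInvolution r (discInvolution r z) = z := by
  have h0 := one_sub_ofReal_mul_ne_zero hr0 hr1.le hz
  have h1 : ((1 - r ^ 2 : ℝ) : ℂ) ≠ 0 := by
    norm_cast; nlinarith
  rw [discInvolution, one_sub_mul_discInvolution hr0 hr1.le hz, discInvolution,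
    div_eq_iff (div_ne_zero h1 h0), mul_div_assoc', sub_eq_iff_eq_add, ← add_div, eq_div_iff h0]
  push_cast
  ring

theorem hasDerivAt_discInvolution {r : ℝ} (hr0 : 0 ≤ r) (hr1 : r ≤ 1) {z : ℂ}
    (hz : z ∈ ball (0 : ℂ) 1) :
    HasDerivAt (discInvolution r) (-((1 - r ^ 2 : ℝ) : ℂ) / (1 - r * z) ^ 2) z := by
  have h0 := one_sub_ofReal_mul_ne_zero hr0 hr1 hz
  have h := ((hasDerivAt_id z).const_sub (r : ℂ)).div
    (((hasDerivAt_id z).const_mul (r : ℂ)).const_sub 1) h0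
  refine h.congr_deriv ?_
  congr 1
  simp only [id]
  push_cast
  ring

/-- Change of variables by a disc automorphism in a weighted integral of a power of
`|1 - r z|`. -/
theorem lintegral_comp_discInvolution {r s p : ℝ} (hr0 : 0 ≤ r) (hr1 : r < 1)
    (F : ℂ → ℝ≥0∞) :
    ∫⁻ z, ENNReal.ofReal ((1 - r ^ 2) ^ p * ‖1 - r * z‖ ^ (-(s + p))) * F z ∂(discMeasure s) =
      ∫⁻ z, ENNReal.ofReal (‖1 - r * z‖ ^ (p - s)) * F (discInvolution r z) ∂(discMeasure s) := by
  have himg : discInvolution r '' ball (0 : ℂ) 1 = ball (0 : ℂ) 1 := by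
    refine Set.Subset.antisymm ?_ fun z hz => ?_
    · rintro _ ⟨z, hz, rfl⟩
      exact discInvolution_mem_ball hr0 hr1 hz
    · exact ⟨_, discInvolution_mem_ball hr0 hr1 hz, discInvolution_discInvolution hr0 hr1 hz⟩
  have hinj : Set.InjOn (discInvolution r) (ball (0 : ℂ) 1) := by
    intro z hz w hw h
    rw [← discInvolution_discInvolution hr0 hr1 hz, h, discInvolution_discInvolution hr0 hr1 hw]
  rw [lintegral_discMeasure, lintegral_discMeasure]
  -- The disc on the left is rewritten as its own image under the involution, so that the area
  -- formula applies.
  nth_rewrite 1 [← himg]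
  rw [lintegral_image_eq_lintegral_norm_deriv_sq_mul measurableSet_ball
    (fun x hx => hasDerivAt_discInvolution hr0 hr1.le hx) hinj]
  refine setLIntegral_congr_fun measurableSet_ball fun z hz => ?_
  have h0 := norm_pos_iff.2 (one_sub_ofReal_mul_ne_zero hr0 hr1.le hz)
  have h1 : 0 < 1 - r ^ 2 := by nlinarith
  have h2 : 0 < 1 - ‖z‖ ^ 2 := by
    rw [mem_ball_zero_iff] at hz
    nlinarith [norm_nonneg z]
  rw [one_sub_norm_discInvolution_sq hr0 hr1.le hz, one_sub_mul_discInvolution hr0 hr1.le hz,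
    norm_div, norm_div, norm_neg, norm_pow, Complex.norm_real, Real.norm_of_nonneg h1.le,
    ← mul_assoc, ← mul_assoc, ← mul_assoc, ← ENNReal.ofReal_mul (by positivity),
    ← ENNReal.ofReal_mul (by positivity), ← ENNReal.ofReal_mul (by positivity)]
  congr 2
  set d := ‖1 - (r : ℂ) * z‖
  set u := 1 - r ^ 2
  have e1 : (d ^ 2) ^ (s - 2) = d ^ (2 * (s - 2)) := by
    rw [← Real.rpow_natCast, ← Real.rpow_mul h0.le]; norm_num
  have e0 : (u / d ^ 2) ^ 2 = u ^ (2 : ℝ) / d ^ ((2 : ℝ) * 2) := by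
    rw [Real.rpow_mul h0.le, Real.rpow_two, Real.rpow_two, Real.rpow_two, div_pow]
  rw [Real.div_rpow (by positivity) (by positivity), Real.mul_rpow h1.le h2.le,
    Real.div_rpow h1.le h0.le, e1, e0]
  -- Bookkeeping of exponents: the powers of u = 1 - r² cancel, and those of d = |1 - rz| leave -4 -
  -- 2(s-2) + (s+p) = p - s.
  have e2 : u ^ (2 : ℝ) * u ^ (s - 2) * (u ^ p * u ^ (-(s + p))) = 1 := by
    rw [← Real.rpow_add h1, ← Real.rpow_add h1, ← Real.rpow_add h1]
    ring_nf; simp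
  have e3 : d ^ (p - s) * d ^ ((2 : ℝ) * 2) * d ^ (2 * (s - 2)) * d ^ (-(s + p)) = 1 := by
    rw [← Real.rpow_add h0, ← Real.rpow_add h0, ← Real.rpow_add h0]
    ring_nf; simp
  have hd1 := Real.rpow_pos_of_pos h0 ((2 : ℝ) * 2)
  have hd2 := Real.rpow_pos_of_pos h0 (2 * (s - 2))
  have hd3 := Real.rpow_pos_of_pos h0 (-(s + p))
  generalize d ^ ((2 : ℝ) * 2) = D, u ^ (2 : ℝ) = U at *
  field_simp
  linear_combination e2 - e3

/-! ### Rotation invariance, Parseval and monotonicity in the radius -/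

theorem measurePreserving_withDensity_comp_norm {E : Type*} [NormedAddCommGroup E]
    [InnerProductSpace ℝ E] [FiniteDimensional ℝ E] [MeasurableSpace E] [BorelSpace E]
    (e : E ≃ₗᵢ[ℝ] E) {φ : ℝ → ℝ≥0∞} (hφ : Measurable φ) :
    MeasurePreserving e ((volume.restrict (ball (0 : E) 1)).withDensity fun z => φ ‖z‖)
      ((volume.restrict (ball (0 : E) 1)).withDensity fun z => φ ‖z‖) := by
  have hm : Measurable e := e.continuous.measurable
  have hr : MeasurePreserving e (volume.restrict (ball (0 : E) 1))
      (volume.restrict (ball (0 : E) 1)) := by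
    have := e.measurePreserving.restrict_preimage (measurableSet_ball (x := (0 : E)) (ε := 1))
    rwa [e.preimage_ball, map_zero] at this
  refine ⟨hm, Measure.ext_of_lintegral _ fun f hf => ?_⟩
  rw [lintegral_map hf hm, lintegral_withDensity_eq_lintegral_mul _ (by fun_prop) (by fun_prop),
    lintegral_withDensity_eq_lintegral_mul _ (by fun_prop) hf]
  have := hr.lintegral_comp (f := fun a => φ ‖a‖ * f a) (by fun_prop)
  simpa using this

theorem exists_hasSum_one_sub_cpow (q : ℂ) :
    ∃ a : ℕ → ℂ, (∀ z ∈ ball (0 : ℂ) 1, HasSum (fun k => a k * z ^ k) ((1 - z) ^ q)) ∧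
      ∀ r : ℝ, 0 ≤ r → r < 1 → Summable fun k => ‖a k‖ * r ^ k := by
  have h := Complex.one_div_one_sub_cpow_hasFPowerSeriesOnBall_zero (-q)
  refine ⟨fun n => Ring.choose (-q + n - 1) n, fun z hz => ?_, fun r hr0 hr1 => ?_⟩
  · have hz' : z ∈ eball (0 : ℂ) 1 := by
      rw [← ENNReal.ofReal_one, Metric.eball_ofReal]; exact hz
    have := h.hasSum hz'
    simpa [FormalMultilinearSeries.ofScalars_apply_eq, Complex.cpow_neg, mul_comm] using this
  · have hr : (r : ℂ) ∈ eball (0 : ℂ) 1 := by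
      rw [← ENNReal.ofReal_one, Metric.eball_ofReal, mem_ball_zero_iff]
      simpa [abs_of_nonneg hr0] using hr1
    have := FormalMultilinearSeries.summable_norm_apply _
      (Metric.eball_subset_eball h.r_le hr)
    simpa [FormalMultilinearSeries.ofScalars_apply_eq, abs_of_nonneg hr0, mul_comm] using this

/-- At p = s the integrand |1-z|^(p-s) is 1, so the extremal integral is the total mass. -/
theorem isFiniteMeasure_discMeasure {s : ℝ} (hs : 1 < s) : IsFiniteMeasure (discMeasure s) := by
  refine ⟨?_⟩
  have h := lintegral_norm_one_sub_rpow (p := s) (s := s) (by linarith) hs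
  simp only [sub_self, Real.rpow_zero, ENNReal.ofReal_one, lintegral_one] at h
  rw [h]
  exact ENNReal.ofReal_lt_top

theorem ae_discMeasure_mem_ball (s : ℝ) : ∀ᵐ z ∂(discMeasure s), z ∈ ball (0 : ℂ) 1 :=
  (withDensity_absolutelyContinuous _ _).ae_le (ae_restrict_mem measurableSet_ball)

theorem measurePreserving_rotation_discMeasure (s : ℝ) (c : Circle) :
    MeasurePreserving (rotation c) (discMeasure s) (discMeasure s) :=
  measurePreserving_withDensity_comp_norm (rotation c)
    (φ := fun t => ENNReal.ofReal ((1 - t ^ 2) ^ (s - 2))) (by fun_prop)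

/-- Rotation by the angle π/(k-l) multiplies the integrand by e^(iπ) = -1 and preserves the measure,
so the integral equals its own negative. -/
theorem integral_pow_mul_conj_pow_discMeasure (s : ℝ) {k l : ℕ} (hkl : k ≠ l) :
    ∫ z, z ^ k * (starRingEnd ℂ) z ^ l ∂(discMeasure s) = 0 := by
  have hd : ((k : ℝ) - l) ≠ 0 := sub_ne_zero.2 (by exact_mod_cast hkl)
  set c : Circle := Circle.exp (Real.pi / (k - l)) with hc
  have h := (measurePreserving_rotation_discMeasure s c).integral_comp
    (rotation c).toHomeomorph.measurableEmbedding (fun z => z ^ k * (starRingEnd ℂ) z ^ l)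
  have hc1 : (c : ℂ) ^ k * (starRingEnd ℂ) (c : ℂ) ^ l = -1 := by
    rw [← map_pow, hc, Circle.coe_exp, ← Complex.exp_nat_mul, ← Complex.exp_nat_mul,
      ← Complex.exp_conj, ← Complex.exp_add, ← Complex.exp_pi_mul_I]
    congr 1
    simp only [map_mul, map_natCast, Complex.conj_I, Complex.conj_ofReal]
    have hd' : ((k : ℂ) - l) ≠ 0 := by exact_mod_cast hd
    push_cast
    field_simp
    ring
  have h2 : ∀ z : ℂ, (rotation c z) ^ k * (starRingEnd ℂ) (rotation c z) ^ l =
      -(z ^ k * (starRingEnd ℂ) z ^ l) := by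
    intro z
    rw [rotation_apply, map_mul, mul_pow, mul_pow]
    linear_combination (z ^ k * (starRingEnd ℂ) z ^ l) * hc1
  simp_rw [h2] at h
  rw [integral_neg] at h
  exact self_eq_neg.1 h.symm

/-- Parseval's identity for the weighted measure on the disc. -/
theorem hasSum_sq_integral_discMeasure {s : ℝ} (hs : 1 < s) {c : ℕ → ℂ}
    (hc : Summable fun k => ‖c k‖) {h : ℂ → ℂ} (hm : Measurable h)
    (hh : ∀ z ∈ ball (0 : ℂ) 1, HasSum (fun k => c k * z ^ k) (h z)) :
    HasSum (fun k => ‖c k‖ ^ 2 * ∫ z, ‖z‖ ^ (2 * k) ∂(discMeasure s))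
      (∫ z, ‖h z‖ ^ 2 ∂(discMeasure s)) := by
  have := isFiniteMeasure_discMeasure hs
  set ν := discMeasure s
  have hb := ae_discMeasure_mem_ball s
  have hpow : ∀ z ∈ ball (0 : ℂ) 1, ∀ k : ℕ, ‖z‖ ^ k ≤ 1 := fun z hz k =>
    pow_le_one₀ (norm_nonneg _) (by rw [mem_ball_zero_iff] at hz; exact hz.le)
  have hbound : ∀ z ∈ ball (0 : ℂ) 1, ‖h z‖ ≤ ∑' k, ‖c k‖ := by
    intro z hz
    rw [← (hh z hz).tsum_eq]
    refine tsum_of_norm_bounded hc.hasSum fun k => ?_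
    rw [norm_mul, norm_pow]
    exact mul_le_of_le_one_right (norm_nonneg _) (hpow z hz k)
  -- Expanding the conjugate of h termwise, orthogonality keeps only the term l = k; a second
  -- expansion, of h itself, then gives the sum of squares.
  have hinner : ∀ k : ℕ, ∫ z, z ^ k * (starRingEnd ℂ) (h z) ∂ν =
      (starRingEnd ℂ) (c k) * ((∫ z, ‖z‖ ^ (2 * k) ∂ν : ℝ) : ℂ) := by
    intro k
    have h1 := hasSum_integral_of_dominated_convergence (μ := ν)
      (F := fun l z => z ^ k * (starRingEnd ℂ) (c l * z ^ l))
      (f := fun z => z ^ k * (starRingEnd ℂ) (h z)) (fun l _ => ‖c l‖)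
      (fun l => (Measurable.aestronglyMeasurable (by fun_prop)))
      (fun l => by
        filter_upwards [hb] with z hz
        rw [norm_mul, RCLike.norm_conj, norm_mul, norm_pow, norm_pow]
        calc ‖z‖ ^ k * (‖c l‖ * ‖z‖ ^ l) ≤ 1 * (‖c l‖ * 1) := by
              gcongr
              · exact hpow z hz k
              · exact hpow z hz l
          _ = ‖c l‖ := by ring)
      (Eventually.of_forall fun _ => hc) (integrable_const _)
      (by
        filter_upwards [hb] with z hz
        exact ((hh z hz).map (starRingEnd ℂ) RCLike.continuous_conj).mul_left _)
    have h2 : ∀ l, ∫ z, z ^ k * (starRingEnd ℂ) (c l * z ^ l) ∂ν =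
        (starRingEnd ℂ) (c l) * ∫ z, z ^ k * (starRingEnd ℂ) z ^ l ∂ν := by
      intro l
      rw [← integral_const_mul]
      refine integral_congr_ae (Eventually.of_forall fun z => ?_)
      simp only [map_mul, map_pow]
      ring
    simp_rw [h2] at h1
    have h3 := hasSum_single (f := fun l => (starRingEnd ℂ) (c l) *
      ∫ z, z ^ k * (starRingEnd ℂ) z ^ l ∂ν) k (fun l hl => by
        rw [integral_pow_mul_conj_pow_discMeasure s (Ne.symm hl), mul_zero])
    rw [h1.unique h3, ← integral_complex_ofReal]
    congr 2
    ext z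
    rw [← mul_pow, Complex.mul_conj, pow_mul, Complex.normSq_eq_norm_sq]
    push_cast
    rfl
  have h1 := hasSum_integral_of_dominated_convergence (μ := ν)
      (F := fun k z => c k * z ^ k * (starRingEnd ℂ) (h z))
      (f := fun z => h z * (starRingEnd ℂ) (h z)) (fun l _ => ‖c l‖ * ∑' k, ‖c k‖)
      (fun l => (Measurable.aestronglyMeasurable (by fun_prop)))
      (fun l => by
        filter_upwards [hb] with z hz
        rw [norm_mul, RCLike.norm_conj, norm_mul, norm_pow]
        gcongr
        · exact mul_le_of_le_one_right (norm_nonneg _) (hpow z hz l)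
        · exact hbound z hz)
      (Eventually.of_forall fun _ => hc.mul_right _) (integrable_const _)
      (by
        filter_upwards [hb] with z hz
        exact (hh z hz).mul_right _)
  have h2 : ∀ k, ∫ z, c k * z ^ k * (starRingEnd ℂ) (h z) ∂ν =
      ((‖c k‖ ^ 2 * ∫ z, ‖z‖ ^ (2 * k) ∂ν : ℝ) : ℂ) := by
    intro k
    simp_rw [mul_assoc]
    rw [integral_const_mul, hinner, ← mul_assoc, Complex.mul_conj, Complex.normSq_eq_norm_sq]
    push_cast
    rfl
  have h3 : ∫ z, h z * (starRingEnd ℂ) (h z) ∂ν = ((∫ z, ‖h z‖ ^ 2 ∂ν : ℝ) : ℂ) := by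
    rw [← integral_complex_ofReal]
    congr 1
    ext z
    rw [Complex.mul_conj, Complex.normSq_eq_norm_sq]
  simp_rw [h2] at h1
  rw [h3] at h1
  exact_mod_cast h1

theorem norm_one_sub_ofReal_mul_le {r : ℝ} (hr0 : 0 ≤ r) (hr1 : r ≤ 1) {z : ℂ}
    (hz : z ∈ ball (0 : ℂ) 1) : ‖1 - (r : ℂ) * z‖ ≤ 2 := by
  rw [mem_ball_zero_iff] at hz
  refine (norm_sub_le _ _).trans ?_
  rw [norm_one, norm_mul, Complex.norm_real, Real.norm_of_nonneg hr0]
  nlinarith [norm_nonneg z]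

/-- Both |(1-z) - (1-rz)| ≤ 1-r and 1-r ≤ |1-rz| hold. The bound is uniform in r and supplies the
dominating function for negative exponents. -/
theorem norm_one_sub_le_two_mul {r : ℝ} (hr0 : 0 ≤ r) (hr1 : r ≤ 1) {z : ℂ}
    (hz : z ∈ ball (0 : ℂ) 1) : ‖1 - z‖ ≤ 2 * ‖1 - (r : ℂ) * z‖ := by
  rw [mem_ball_zero_iff] at hz
  have h1 : 1 - r ≤ ‖1 - (r : ℂ) * z‖ := by
    have := norm_sub_norm_le (1 : ℂ) ((r : ℂ) * z)
    rw [norm_one, norm_mul, Complex.norm_real, Real.norm_of_nonneg hr0] at this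
    nlinarith [norm_nonneg z]
  have h2 : ‖(1 - z) - (1 - (r : ℂ) * z)‖ ≤ 1 - r := by
    have : (1 - z) - (1 - (r : ℂ) * z) = -(((1 - r : ℝ) : ℂ) * z) := by push_cast; ring
    rw [this, norm_neg, norm_mul, Complex.norm_real, Real.norm_of_nonneg (by linarith)]
    nlinarith [norm_nonneg z]
  have := norm_sub_norm_le (1 - z) (1 - (r : ℂ) * z)
  linarith

/-- |1-rz|^q is the squared modulus of the holomorphic function (1-rz)^(q/2), so Parseval gives a
series in r² with nonnegative coefficients, whatever the sign of q. -/
theorem lintegral_norm_one_sub_ofReal_mul_mono {s : ℝ} (hs : 1 < s) (q : ℝ) {r r' : ℝ}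
    (hr0 : 0 ≤ r) (hrr : r ≤ r') (hr1 : r' < 1) :
    ∫⁻ z, ENNReal.ofReal (‖1 - (r : ℂ) * z‖ ^ q) ∂(discMeasure s) ≤
      ∫⁻ z, ENNReal.ofReal (‖1 - (r' : ℂ) * z‖ ^ q) ∂(discMeasure s) := by
  have hfin := isFiniteMeasure_discMeasure hs
  obtain ⟨a, ha, hsum⟩ := exists_hasSum_one_sub_cpow ((q / 2 : ℝ) : ℂ)
  have key : ∀ t : ℝ, 0 ≤ t → t < 1 →
      HasSum (fun k => ‖a k‖ ^ 2 * t ^ (2 * k) * ∫ z, ‖z‖ ^ (2 * k) ∂(discMeasure s))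
        (∫ z, ‖1 - (t : ℂ) * z‖ ^ q ∂(discMeasure s)) ∧
      ∫⁻ z, ENNReal.ofReal (‖1 - (t : ℂ) * z‖ ^ q) ∂(discMeasure s) =
        ENNReal.ofReal (∫ z, ‖1 - (t : ℂ) * z‖ ^ q ∂(discMeasure s)) := by
    intro t ht0 ht1
    have hnorm : ∀ z : ℂ, ‖(1 - (t : ℂ) * z) ^ ((q / 2 : ℝ) : ℂ)‖ ^ 2 = ‖1 - (t : ℂ) * z‖ ^ q := by
      intro z
      rw [Complex.norm_cpow_real, ← Real.rpow_natCast, ← Real.rpow_mul (norm_nonneg _)]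
      congr 1
      push_cast
      ring
    have hnc : ∀ k, ‖a k * (t : ℂ) ^ k‖ = ‖a k‖ * t ^ k := fun k => by
      rw [norm_mul, norm_pow, Complex.norm_real, Real.norm_of_nonneg ht0]
    have h := hasSum_sq_integral_discMeasure hs (c := fun k => a k * (t : ℂ) ^ k)
      (h := fun z => (1 - (t : ℂ) * z) ^ ((q / 2 : ℝ) : ℂ))
      (by simpa only [hnc] using hsum t ht0 ht1) (by fun_prop)
      (fun z hz => by
        have hz' : (t : ℂ) * z ∈ ball (0 : ℂ) 1 := by
          rw [mem_ball_zero_iff] at hz ⊢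
          rw [norm_mul, Complex.norm_real, Real.norm_of_nonneg ht0]
          nlinarith [norm_nonneg z]
        simpa only [mul_pow, mul_assoc] using ha _ hz')
    simp only [hnorm, hnc] at h
    refine ⟨by simpa only [mul_pow, pow_mul, pow_right_comm] using h, ?_⟩
    have hlow : ∀ z ∈ ball (0 : ℂ) 1, 1 - t ≤ ‖1 - (t : ℂ) * z‖ := by
      intro z hz
      rw [mem_ball_zero_iff] at hz
      have := norm_sub_norm_le (1 : ℂ) ((t : ℂ) * z)
      rw [norm_one, norm_mul, Complex.norm_real, Real.norm_of_nonneg ht0] at this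
      nlinarith [norm_nonneg z]
    have hint : Integrable (fun z => ‖1 - (t : ℂ) * z‖ ^ q) (discMeasure s) := by
      refine Integrable.of_bound (Measurable.aestronglyMeasurable (by fun_prop))
        (2 ^ q + (1 - t) ^ q) ?_
      filter_upwards [ae_discMeasure_mem_ball s] with z hz
      rw [Real.norm_of_nonneg (by positivity)]
      have h1t : 0 < 1 - t := by linarith
      rcases le_total 0 q with hq | hq
      · have := Real.rpow_le_rpow (norm_nonneg _) (norm_one_sub_ofReal_mul_le ht0 ht1.le hz) hq
        have : 0 ≤ (1 - t) ^ q := by positivity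
        linarith
      · have := Real.rpow_le_rpow_of_nonpos h1t (hlow z hz) hq
        have : (0 : ℝ) ≤ 2 ^ q := by positivity
        linarith
    rw [ofReal_integral_eq_lintegral_ofReal hint]
    filter_upwards with z
    positivity
  have hr' := hr0.trans hrr
  rw [(key r hr0 (hrr.trans_lt hr1)).2, (key r' hr' hr1).2]
  refine ENNReal.ofReal_le_ofReal (hasSum_le (fun k => ?_) (key r hr0 (hrr.trans_lt hr1)).1
    (key r' hr' hr1).1)
  have : 0 ≤ ∫ z, ‖z‖ ^ (2 * k) ∂(discMeasure s) := integral_nonneg fun z => by positivity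
  gcongr

/-! ### The limit as the radius tends to 1 -/

theorem tendsto_norm_one_sub_mul_rpow {z : ℂ} (hz : z ∈ ball (0 : ℂ) 1) (q : ℝ) {u : ℕ → ℝ}
    (hu : Tendsto u atTop (𝓝 1)) :
    Tendsto (fun k => ENNReal.ofReal (‖1 - (u k : ℂ) * z‖ ^ q)) atTop
      (𝓝 (ENNReal.ofReal (‖1 - z‖ ^ q))) := by
  have h0 : ‖1 - z‖ ≠ 0 := by
    simpa using norm_ne_zero_iff.2 (one_sub_ofReal_mul_ne_zero zero_le_one le_rfl hz)
  refine ENNReal.tendsto_ofReal (Tendsto.rpow_const (Tendsto.norm ?_) (Or.inl h0))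
  have := ((Complex.continuous_ofReal.tendsto 1).comp hu).mul_const z
  simpa using this.const_sub 1

theorem exists_seq_tendsto_one :
    ∃ u : ℕ → ℝ, Tendsto u atTop (𝓝 1) ∧ ∀ k, 0 ≤ u k ∧ u k < 1 := by
  obtain ⟨u, -, hu, hlim⟩ := exists_seq_strictMono_tendsto' (zero_lt_one' ℝ)
  exact ⟨u, hlim, fun k => ⟨(hu k).1.le, (hu k).2⟩⟩

theorem lintegral_norm_one_sub_ofReal_mul_le {s p : ℝ} (hs : 1 < s) (hp : 0 < p) {r : ℝ}
    (hr0 : 0 ≤ r) (hr1 : r < 1) :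
    ∫⁻ z, ENNReal.ofReal (‖1 - (r : ℂ) * z‖ ^ (p - s)) ∂(discMeasure s) ≤
      ∫⁻ z, ENNReal.ofReal (‖1 - z‖ ^ (p - s)) ∂(discMeasure s) := by
  have hfin := isFiniteMeasure_discMeasure hs
  obtain ⟨u, hu1, hu01⟩ := exists_seq_tendsto_one
  have hlim := tendsto_lintegral_of_dominated_convergence (μ := discMeasure s)
    (F := fun k z => ENNReal.ofReal (‖1 - (u k : ℂ) * z‖ ^ (p - s)))
    (f := fun z => ENNReal.ofReal (‖1 - z‖ ^ (p - s)))
    -- The first term dominates when p ≥ s, the second when p ≤ s; the second is integrable because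
    -- p > 0.
    (fun z => ENNReal.ofReal (2 ^ (p - s)) +
      ENNReal.ofReal (2 ^ (s - p)) * ENNReal.ofReal (‖1 - z‖ ^ (p - s)))
    (fun k => by fun_prop)
    (fun k => by
      filter_upwards [ae_discMeasure_mem_ball s] with z hz
      obtain ⟨h0, h1⟩ := hu01 k
      rcases le_total 0 (p - s) with hq | hq
      · exact (ENNReal.ofReal_le_ofReal (Real.rpow_le_rpow (norm_nonneg _)
          (norm_one_sub_ofReal_mul_le h0 h1.le hz) hq)).trans le_self_add
      · refine le_trans ?_ le_add_self
        rw [← ENNReal.ofReal_mul (by positivity)]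
        refine ENNReal.ofReal_le_ofReal ?_
        have hpos : 0 < ‖1 - z‖ := by
          simpa using norm_pos_iff.2 (one_sub_ofReal_mul_ne_zero zero_le_one le_rfl hz)
        have := Real.rpow_le_rpow_of_nonpos (by positivity : 0 < ‖1 - z‖ / 2)
          ((div_le_iff₀' two_pos).2 (norm_one_sub_le_two_mul h0 h1.le hz)) hq
        rw [Real.div_rpow (norm_nonneg _) zero_le_two, div_eq_inv_mul, ← Real.rpow_neg zero_le_two,
          neg_sub] at this
        exact this)
    (by
      rw [lintegral_add_left measurable_const, lintegral_const, lintegral_const_mul _ (by fun_prop),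
        lintegral_norm_one_sub_rpow hp hs]
      exact ENNReal.add_ne_top.2 ⟨ENNReal.mul_ne_top ENNReal.ofReal_ne_top (measure_ne_top _ _),
        ENNReal.mul_ne_top ENNReal.ofReal_ne_top ENNReal.ofReal_ne_top⟩)
    (by
      filter_upwards [ae_discMeasure_mem_ball s] with z hz
      exact tendsto_norm_one_sub_mul_rpow hz _ hu1)
  refine ge_of_tendsto hlim ?_
  filter_upwards [hu1.eventually (lt_mem_nhds hr1)] with k hk
  exact lintegral_norm_one_sub_ofReal_mul_mono hs _ hr0 hk.le (hu01 k).2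

/-- Fatou's lemma along radii r → 1: for fixed z in the disc, φ_r(z) → 1, so the extra factor
disappears in the limit. -/
theorem lintegral_norm_one_sub_rpow_le_iSup (s p : ℝ) (N : ℕ) :
    ∫⁻ z, ENNReal.ofReal (‖1 - z‖ ^ (p - s)) ∂(discMeasure s) ≤
      ⨆ (r : ℝ) (_ : 0 ≤ r ∧ r < 1), ∫⁻ z, ENNReal.ofReal (‖1 - (r : ℂ) * z‖ ^ (p - s)) *
        ENNReal.ofReal (‖discInvolution r z‖ ^ N) ∂(discMeasure s) := by
  obtain ⟨u, hu1, hu01⟩ := exists_seq_tendsto_one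
  set F : ℕ → ℂ → ℝ≥0∞ := fun k z => ENNReal.ofReal (‖1 - (u k : ℂ) * z‖ ^ (p - s)) *
        ENNReal.ofReal (‖discInvolution (u k) z‖ ^ N) with hF
  have hFm : ∀ k, Measurable (F k) := fun k => by
    simp only [hF, discInvolution]
    fun_prop
  have hlim : ∀ z ∈ ball (0 : ℂ) 1,
      Tendsto (fun k => F k z) atTop (𝓝 (ENNReal.ofReal (‖1 - z‖ ^ (p - s)))) := by
    intro z hz
    have h0 : 1 - z ≠ 0 := by
      simpa using one_sub_ofReal_mul_ne_zero zero_le_one le_rfl hz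
    have hc := (Complex.continuous_ofReal.tendsto 1).comp hu1
    have h1 : Tendsto (fun k => discInvolution (u k) z) atTop (𝓝 1) := by
      have := (hc.sub_const z).div ((hc.mul_const z).const_sub 1) (by simpa using h0)
      simpa [h0, discInvolution, Pi.div_def] using this
    have h2 : Tendsto (fun k => ENNReal.ofReal (‖discInvolution (u k) z‖ ^ N)) atTop (𝓝 1) := by
      simpa using ENNReal.tendsto_ofReal (h1.norm.pow N)
    have h3 := ENNReal.Tendsto.mul (tendsto_norm_one_sub_mul_rpow hz (p - s) hu1)
      (Or.inr ENNReal.one_ne_top) h2 (Or.inr ENNReal.ofReal_ne_top)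
    rwa [mul_one] at h3
  calc ∫⁻ z, ENNReal.ofReal (‖1 - z‖ ^ (p - s)) ∂(discMeasure s)
      = ∫⁻ z, liminf (fun k => F k z) atTop ∂(discMeasure s) := by
        refine lintegral_congr_ae ?_
        filter_upwards [ae_discMeasure_mem_ball s] with z hz
        exact (hlim z hz).liminf_eq.symm
    _ ≤ liminf (fun k => ∫⁻ z, F k z ∂(discMeasure s)) atTop := lintegral_liminf_le hFm
    _ ≤ _ := by
        refine liminf_le_of_le (by isBoundedDefault) fun b hb => ?_
        obtain ⟨k, hk⟩ := hb.exists
        exact hk.trans (le_iSup₂_of_le (u k) (hu01 k) le_rfl)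

/-! ### From the ball to the disc: slicing and unitary invariance -/

theorem lintegral_weightedVolume {n : ℕ} {α : ℝ} (f : Cn n → ℝ≥0∞) :
    ∫⁻ w, f w ∂(weightedVolume n α) =
      ∫⁻ w in ball (0 : Cn n) 1, ENNReal.ofReal ((1 - ‖w‖ ^ 2) ^ α) * f w := by
  rw [weightedVolume, lintegral_withDensity_eq_lintegral_mul_non_measurable _ (by fun_prop)]
  · rfl
  · filter_upwards with x using ENNReal.ofReal_lt_top

/-- Splitting off the first coordinate, as an isometry of Euclidean spaces. -/
def consIsometry (k : ℕ) : WithLp 2 (ℂ × Cn k) ≃ₗᵢ[ℝ] Cn (k + 1) where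
  toFun p := WithLp.toLp 2 (Fin.cons p.fst p.snd)
  invFun w := WithLp.toLp 2 (w 0, WithLp.toLp 2 fun i => w i.succ)
  left_inv p := rfl
  right_inv w := by
    ext i
    refine Fin.cases ?_ (fun i => ?_) i <;> simp
  map_add' p q := by
    ext i
    refine Fin.cases ?_ (fun i => ?_) i <;> simp
  map_smul' c p := by
    ext i
    refine Fin.cases ?_ (fun i => ?_) i <;> simp
  norm_map' p := by
    have h : ‖(WithLp.toLp 2 (Fin.cons p.fst p.snd) : Cn (k + 1))‖ ^ 2 = ‖p‖ ^ 2 := by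
      rw [EuclideanSpace.norm_sq_eq, Fin.sum_univ_succ, WithLp.prod_norm_sq_eq_of_L2,
        EuclideanSpace.norm_sq_eq]
      simp
    exact (sq_eq_sq₀ (norm_nonneg _) (norm_nonneg _)).1 h

theorem consIsometry_zero {k : ℕ} (ζ : ℂ) (v : Cn k) :
    consIsometry k (WithLp.toLp 2 (ζ, v)) 0 = ζ := rfl

theorem lintegral_eq_lintegral_cons {k : ℕ} {f : Cn (k + 1) → ℝ≥0∞} (hf : Measurable f) :
    ∫⁻ w, f w = ∫⁻ ζ : ℂ, ∫⁻ v : Cn k, f (consIsometry k (WithLp.toLp 2 (ζ, v))) := by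
  have h := (consIsometry k).measurePreserving.comp (WithLp.volume_preserving_toLp ℂ (Cn k))
  rw [← h.lintegral_comp hf, Measure.volume_eq_prod, lintegral_prod]
  · rfl
  · exact (hf.comp h.measurable).aemeasurable

/-- The slice over ζ is a ball of radius √(1-|ζ|²) in real dimension 2k. Rescaling it to the unit
ball yields (1-|ζ|²)^k from the volume and (1-|ζ|²)^α from the weight, and k + α = (k+2+α) - 2. -/
theorem lintegral_weightedVolume_succ (k : ℕ) (α : ℝ) {f : ℂ → ℝ≥0∞} (hf : Measurable f) :
    ∫⁻ w, f (w 0) ∂(weightedVolume (k + 1) α) =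
      weightedVolume k α Set.univ * ∫⁻ ζ, f ζ ∂(discMeasure (k + 2 + α)) := by
  have hfin : Module.finrank ℝ (Cn k) = 2 * k := by
    rw [← Module.finrank_mul_finrank ℝ ℂ (Cn k)]
    simp
  rw [lintegral_weightedVolume, ← lintegral_indicator measurableSet_ball,
    lintegral_eq_lintegral_cons (Measurable.indicator (by fun_prop) measurableSet_ball),
    lintegral_discMeasure, ← lintegral_indicator measurableSet_ball,
    ← lintegral_const_mul _ (Measurable.indicator (by fun_prop) measurableSet_ball)]
  refine lintegral_congr fun ζ => ?_
  have hn : ∀ v : Cn k, ‖consIsometry k (WithLp.toLp 2 (ζ, v))‖ ^ 2 = ‖ζ‖ ^ 2 + ‖v‖ ^ 2 := by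
    intro v
    rw [LinearIsometryEquiv.norm_map, WithLp.prod_norm_sq_eq_of_L2]
    rfl
  have hmem : ∀ v : Cn k, consIsometry k (WithLp.toLp 2 (ζ, v)) ∈ ball (0 : Cn (k + 1)) 1 ↔
      ‖ζ‖ ^ 2 + ‖v‖ ^ 2 < 1 := by
    intro v
    rw [← hn, mem_ball_zero_iff, sq_lt_one_iff₀ (norm_nonneg _)]
  by_cases hζ : ζ ∈ ball (0 : ℂ) 1
  · have ht : 0 < 1 - ‖ζ‖ ^ 2 := by
      rw [mem_ball_zero_iff] at hζ
      nlinarith [norm_nonneg ζ]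
    have hs : 0 < √(1 - ‖ζ‖ ^ 2) := Real.sqrt_pos.2 ht
    have hsq : √(1 - ‖ζ‖ ^ 2) ^ 2 = 1 - ‖ζ‖ ^ 2 := Real.sq_sqrt ht.le
    rw [Set.indicator_of_mem hζ, lintegral_comp_smul_addHaar volume hs, hfin, pow_mul, hsq]
    have hv : ∀ v : Cn k, (ball (0 : Cn (k + 1)) 1).indicator
        (fun a => ENNReal.ofReal ((1 - ‖a‖ ^ 2) ^ α) * f (a 0))
        (consIsometry k (WithLp.toLp 2 (ζ, √(1 - ‖ζ‖ ^ 2) • v))) =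
        (ENNReal.ofReal ((1 - ‖ζ‖ ^ 2) ^ α) * f ζ) * (ball (0 : Cn k) 1).indicator
          (fun v => ENNReal.ofReal ((1 - ‖v‖ ^ 2) ^ α)) v := by
      intro v
      have hnv : 1 - (‖ζ‖ ^ 2 + ‖√(1 - ‖ζ‖ ^ 2) • v‖ ^ 2) = (1 - ‖ζ‖ ^ 2) * (1 - ‖v‖ ^ 2) := by
        rw [norm_smul, mul_pow, Real.norm_of_nonneg hs.le, hsq]
        ring
      by_cases hvb : v ∈ ball (0 : Cn k) 1
      · have hv1 : 0 < 1 - ‖v‖ ^ 2 := by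
          rw [mem_ball_zero_iff] at hvb
          nlinarith [norm_nonneg v]
        have : 0 < (1 - ‖ζ‖ ^ 2) * (1 - ‖v‖ ^ 2) := mul_pos ht hv1
        rw [Set.indicator_of_mem hvb, Set.indicator_of_mem ((hmem _).2 (by linarith)), hn, hnv,
          Real.mul_rpow ht.le hv1.le, ENNReal.ofReal_mul (by positivity), consIsometry_zero]
        ring
      · have hv1 : 1 - ‖v‖ ^ 2 ≤ 0 := by
          rw [mem_ball_zero_iff, not_lt] at hvb
          nlinarith
        have : (1 - ‖ζ‖ ^ 2) * (1 - ‖v‖ ^ 2) ≤ 0 := mul_nonpos_of_nonneg_of_nonpos ht.le hv1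
        rw [Set.indicator_of_notMem hvb, Set.indicator_of_notMem (fun h => by
          have := (hmem _).1 h; linarith), mul_zero]
    simp_rw [hv]
    have hW : weightedVolume k α Set.univ =
        ∫⁻ v in ball (0 : Cn k) 1, ENNReal.ofReal ((1 - ‖v‖ ^ 2) ^ α) := by
      rw [weightedVolume, withDensity_apply _ MeasurableSet.univ, Measure.restrict_univ]
    rw [lintegral_const_mul _ (Measurable.indicator (by fun_prop) measurableSet_ball),
      lintegral_indicator measurableSet_ball, ← hW, show (k : ℝ) + 2 + α - 2 = k + α by ring,
      Real.rpow_add ht, Real.rpow_natCast, ENNReal.ofReal_mul (by positivity)]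
    ring
  · have hζ1 : 1 ≤ ‖ζ‖ := by rwa [mem_ball_zero_iff, not_lt] at hζ
    rw [Set.indicator_of_notMem hζ, mul_zero]
    have : ∀ v : Cn k, (ball (0 : Cn (k + 1)) 1).indicator
        (fun a => ENNReal.ofReal ((1 - ‖a‖ ^ 2) ^ α) * f (a 0))
        (consIsometry k (WithLp.toLp 2 (ζ, v))) = 0 := fun v =>
      Set.indicator_of_notMem (fun h => by
        have := (hmem _).1 h
        nlinarith [sq_nonneg ‖v‖]) _
    simp [this]

theorem discMeasure_univ {s : ℝ} (hs : 1 < s) : discMeasure s Set.univ =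
    ENNReal.ofReal (Real.pi * Real.Gamma (s - 1) / Real.Gamma s) := by
  have h := lintegral_norm_one_sub_rpow (p := s) (s := s) (by linarith) hs
  have hG : 0 < Real.Gamma s := Real.Gamma_pos_of_pos (by linarith)
  simp only [sub_self, Real.rpow_zero, ENNReal.ofReal_one, lintegral_one] at h
  rw [h, show (s + s) / 2 = s by ring]
  congr 1
  field_simp

theorem discMeasure_univ_ne_zero {s : ℝ} (hs : 1 < s) : discMeasure s Set.univ ≠ 0 := by
  have h1 : 0 < Real.Gamma s := Real.Gamma_pos_of_pos (by linarith)
  have h2 : 0 < Real.Gamma (s - 1) := Real.Gamma_pos_of_pos (by linarith)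
  rw [discMeasure_univ hs, ne_eq, ENNReal.ofReal_eq_zero, not_le]
  positivity

theorem weightedVolume_univ {n : ℕ} {α : ℝ} (hα : -1 < α) :
    weightedVolume n α Set.univ ≠ 0 ∧ weightedVolume n α Set.univ ≠ ⊤ := by
  induction n with
  | zero =>
    have h : weightedVolume 0 α Set.univ = volume (ball (0 : Cn 0) 1) := by
      rw [weightedVolume, withDensity_apply _ MeasurableSet.univ, Measure.restrict_univ,
        ← setLIntegral_one]
      refine lintegral_congr fun z => ?_
      rw [Subsingleton.elim z 0]
      simp
    rw [h]
    exact ⟨(measure_ball_pos _ _ one_pos).ne', measure_ball_lt_top.ne⟩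
  | succ k ih =>
    have hs : (1 : ℝ) < k + 2 + α := by linarith [(Nat.cast_nonneg k : (0 : ℝ) ≤ k)]
    have := isFiniteMeasure_discMeasure hs
    have h := lintegral_weightedVolume_succ k α (f := fun _ => 1) measurable_const
    simp only [lintegral_one] at h
    rw [h]
    exact ⟨mul_ne_zero ih.1 (discMeasure_univ_ne_zero hs), ENNReal.mul_ne_top ih.2
      (measure_ne_top _ _)⟩

theorem isProbabilityMeasure_weightedMeasure {n : ℕ} {α : ℝ} (hα : -1 < α) :
    IsProbabilityMeasure (weightedMeasure n α) := by
  obtain ⟨h0, h1⟩ := weightedVolume_univ (n := n) hα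
  exact ⟨by simp [weightedMeasure, ENNReal.inv_mul_cancel h0 h1]⟩

theorem ae_weightedMeasure_mem_ball (n : ℕ) (α : ℝ) :
    ∀ᵐ w ∂(weightedMeasure n α), w ∈ ball (0 : Cn n) 1 :=
  Measure.ae_smul_measure ((withDensity_absolutelyContinuous _ _).ae_le
    (ae_restrict_mem measurableSet_ball)) _

/-- The first coordinate is distributed according to a normalized weighted measure on the disc. -/
theorem lintegral_weightedMeasure_succ (k : ℕ) {α : ℝ} (hα : -1 < α) {f : ℂ → ℝ≥0∞}
    (hf : Measurable f) :
    ∫⁻ w, f (w 0) ∂(weightedMeasure (k + 1) α) =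
      (discMeasure (k + 2 + α) Set.univ)⁻¹ * ∫⁻ ζ, f ζ ∂(discMeasure (k + 2 + α)) := by
  obtain ⟨h0, h1⟩ := weightedVolume_univ (n := k) hα
  have h := lintegral_weightedVolume_succ k α (f := fun _ => 1) measurable_const
  simp only [lintegral_one] at h
  rw [weightedMeasure, lintegral_smul_measure, lintegral_weightedVolume_succ k α hf, h,
    ENNReal.mul_inv (Or.inl h0) (Or.inl h1), smul_eq_mul]
  calc (weightedVolume k α Set.univ)⁻¹ * (discMeasure (k + 2 + α) Set.univ)⁻¹ *
        (weightedVolume k α Set.univ * ∫⁻ ζ, f ζ ∂(discMeasure (k + 2 + α)))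
      = ((weightedVolume k α Set.univ)⁻¹ * weightedVolume k α Set.univ) *
        ((discMeasure (k + 2 + α) Set.univ)⁻¹ * ∫⁻ ζ, f ζ ∂(discMeasure (k + 2 + α))) := by ring
    _ = _ := by rw [ENNReal.inv_mul_cancel h0 h1, one_mul]

theorem measurePreserving_weightedMeasure {n : ℕ} (α : ℝ) (e : Cn n ≃ₗᵢ[ℂ] Cn n) :
    MeasurePreserving e (weightedMeasure n α) (weightedMeasure n α) := by
  have h := measurePreserving_withDensity_comp_norm 
    { e.toLinearEquiv.restrictScalars ℝ with norm_map' := e.norm_map }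
    (φ := fun t => ENNReal.ofReal ((1 - t ^ 2) ^ α)) (by fun_prop)
  exact h.smul_measure (weightedVolume n α Set.univ)⁻¹

/-- For z ≠ 0, extend z/|z| to an orthonormal basis as its vector of index 0 and take coordinates.
-/
theorem exists_linearIsometryEquiv_single {k : ℕ} (z : Cn (k + 1)) :
    ∃ e : Cn (k + 1) ≃ₗᵢ[ℂ] Cn (k + 1), e z = EuclideanSpace.single 0 (‖z‖ : ℂ) := by
  by_cases hz : z = 0
  · exact ⟨LinearIsometryEquiv.refl ℂ _, by ext; simp [hz]⟩
  have hz' : (‖z‖ : ℂ) ≠ 0 := by simpa using hz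
  have hv : Orthonormal ℂ
      (Set.domRestrict ({0} : Set (Fin (k + 1))) fun _ => ((‖z‖ : ℂ)⁻¹ • z)) := by
    rw [orthonormal_iff_ite]
    rintro ⟨i, hi⟩ ⟨j, hj⟩
    obtain rfl : i = 0 := hi
    obtain rfl : j = 0 := hj
    rw [if_pos rfl]
    simp only [Set.domRestrict]
    rw [inner_self_eq_norm_sq_to_K, norm_smul, norm_inv, Complex.norm_real, norm_norm,
      inv_mul_cancel₀ (norm_ne_zero_iff.2 hz)]
    simp
  obtain ⟨b, hb⟩ := hv.exists_orthonormalBasis_extension_of_card_eq (by simp)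
  have hb0 : b 0 = (‖z‖ : ℂ)⁻¹ • z := hb 0 rfl
  refine ⟨b.repr, ?_⟩
  have : z = (‖z‖ : ℂ) • b 0 := by rw [hb0, smul_smul, mul_inv_cancel₀ hz', one_smul]
  nth_rewrite 1 [this]
  rw [map_smul, b.repr_self]
  ext i
  simp

theorem norm_one_sub_inner_single {k : ℕ} (w : Cn (k + 1)) (r : ℝ) :
    ‖1 - inner ℂ w (EuclideanSpace.single 0 (r : ℂ))‖ = ‖1 - (r : ℂ) * w 0‖ := by
  rw [EuclideanSpace.inner_single_right, ← RCLike.norm_conj]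
  simp

theorem lintegral_norm_one_sub_inner_rpow (k : ℕ) {α : ℝ} (hα : -1 < α) (q : ℝ)
    (z : Cn (k + 1)) :
    ∫⁻ w, ENNReal.ofReal (‖1 - inner ℂ w z‖ ^ q) ∂(weightedMeasure (k + 1) α) =
      (discMeasure (k + 2 + α) Set.univ)⁻¹ *
        ∫⁻ ζ, ENNReal.ofReal (‖1 - (‖z‖ : ℂ) * ζ‖ ^ q) ∂(discMeasure (k + 2 + α)) := by
  obtain ⟨e, he⟩ := exists_linearIsometryEquiv_single z
  rw [← lintegral_weightedMeasure_succ k hα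
      (f := fun ζ => ENNReal.ofReal (‖1 - (‖z‖ : ℂ) * ζ‖ ^ q)) (by fun_prop),
    ← (measurePreserving_weightedMeasure α e).lintegral_comp
      (f := fun w => ENNReal.ofReal (‖1 - (‖z‖ : ℂ) * w 0‖ ^ q)) (by fun_prop)]
  refine lintegral_congr fun w => ?_
  rw [← norm_one_sub_inner_single, ← he, LinearIsometryEquiv.inner_map_map]

/-! ### Differentiation under the integral sign -/

theorem re_one_sub_inner {n : ℕ} {z w : Cn n} {ρ : ℝ} (hz : ‖z‖ ≤ ρ) (hw : ‖w‖ ≤ 1) :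
    1 - ρ ≤ (1 - inner ℂ w z : ℂ).re := by
  have h1 : ‖(inner ℂ w z : ℂ)‖ ≤ ‖w‖ * ‖z‖ := norm_inner_le_norm w z
  have h2 := Complex.re_le_norm (inner ℂ w z)
  rw [Complex.sub_re, Complex.one_re]
  nlinarith [norm_nonneg z, norm_nonneg w]

theorem norm_one_sub_inner_cpow_le {n : ℕ} {z w : Cn n} {ρ s : ℝ} (hz : ‖z‖ ≤ ρ) (hρ : ρ < 1)
    (hw : ‖w‖ ≤ 1) (hs : 0 ≤ s) :
    ‖(1 - inner ℂ w z : ℂ) ^ (-(s : ℂ))‖ ≤ (1 - ρ) ^ (-s) := by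
  rw [← Complex.ofReal_neg, Complex.norm_cpow_real]
  exact Real.rpow_le_rpow_of_nonpos (by linarith)
    ((re_one_sub_inner hz hw).trans (Complex.re_le_norm _)) (by linarith)

/-- Essentially bounded measurable functions. -/
def IsEssBounded {n : ℕ} (μ : Measure (Cn n)) (u : Cn n → ℂ) : Prop :=
  AEStronglyMeasurable u μ ∧ ∃ C : ℝ, ∀ᵐ w ∂μ, ‖u w‖ ≤ C

theorem IsEssBounded.conj_mul {n : ℕ} {α : ℝ} {u : Cn n → ℂ}
    (hu : IsEssBounded (weightedMeasure n α) u) (i : Fin n) :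
    IsEssBounded (weightedMeasure n α) fun w => (starRingEnd ℂ) (w i) * u w := by
  obtain ⟨hm, C, hC⟩ := hu
  refine ⟨AEStronglyMeasurable.mul (Measurable.aestronglyMeasurable (by fun_prop)) hm, C, ?_⟩
  filter_upwards [hC, ae_weightedMeasure_mem_ball n α] with w hw hb
  rw [mem_ball_zero_iff] at hb
  rw [norm_mul, RCLike.norm_conj]
  exact (mul_le_of_le_one_left (norm_nonneg _) ((PiLp.norm_apply_le w i).trans hb.le)).trans hw

/-- The integral `Γ(s) ∫ u(w) (1 - ⟨z, w⟩)^(-s) dv_α(w)`. -/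
def kernelIntegral (n : ℕ) (α s : ℝ) (u : Cn n → ℂ) (z : Cn n) : ℂ :=
  Real.Gamma s * ∫ w, u w * (1 - inner ℂ w z) ^ (-(s : ℂ)) ∂(weightedMeasure n α)

theorem hasFDerivAt_one_sub_inner_cpow {n : ℕ} {z w : Cn n} (hz : ‖z‖ < 1) (hw : ‖w‖ ≤ 1)
    (s : ℝ) :
    HasFDerivAt (fun z => (1 - inner ℂ w z : ℂ) ^ (-(s : ℂ)))
      (((s : ℂ) * (1 - inner ℂ w z : ℂ) ^ (-((s + 1 : ℝ) : ℂ))) • innerSL ℂ w) z := by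
  have h0 : (1 - inner ℂ w z : ℂ) ∈ Complex.slitPlane :=
    Or.inl (by linarith [re_one_sub_inner le_rfl hw (z := z)])
  have h1 : HasFDerivAt (fun z => (1 - inner ℂ w z : ℂ)) (-(innerSL ℂ w)) z :=
    (innerSL ℂ w).hasFDerivAt.const_sub 1
  have h2 :=
    (Complex.hasStrictDerivAt_cpow_const (c := -(s : ℂ)) h0).hasDerivAt.comp_hasFDerivAt z h1
  refine h2.congr_fderiv ?_
  rw [smul_neg, ← neg_smul]
  congr 1
  push_cast
  ring_nf

theorem integrable_mul_cpow_smul {n : ℕ} {α s : ℝ} (hα : -1 < α) (hs : 0 < s) {u : Cn n → ℂ}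
    (hu : IsEssBounded (weightedMeasure n α) u) {z : Cn n} (hz : z ∈ ball (0 : Cn n) 1) :
    Integrable (fun w => u w * (1 - inner ℂ w z) ^ (-(s : ℂ))) (weightedMeasure n α) := by
  have := isProbabilityMeasure_weightedMeasure (n := n) hα
  obtain ⟨hm, C, hC⟩ := hu
  rw [mem_ball_zero_iff] at hz
  refine Integrable.of_bound (hm.mul (Measurable.aestronglyMeasurable (by fun_prop)))
    (C * (1 - ‖z‖) ^ (-s)) ?_
  filter_upwards [hC, ae_weightedMeasure_mem_ball n α] with w hw hb
  rw [mem_ball_zero_iff] at hb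
  rw [norm_mul]
  exact mul_le_mul hw (norm_one_sub_inner_cpow_le le_rfl hz hb.le hs.le) (norm_nonneg _)
    ((norm_nonneg _).trans hw)

/-- The factor s produced by the derivative is absorbed by sΓ(s) = Γ(s+1), so each derivative merely
shifts s and multiplies the density by a conjugate coordinate. -/
theorem hasFDerivAt_kernelIntegral {n : ℕ} {α s : ℝ} (hα : -1 < α) (hs : 0 < s)
    {u : Cn n → ℂ} (hu : IsEssBounded (weightedMeasure n α) u) {z : Cn n}
    (hz : z ∈ ball (0 : Cn n) 1) :
    ∃ L : Cn n →L[ℂ] ℂ, HasFDerivAt (kernelIntegral n α s u) L z ∧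
      ∀ i, L (EuclideanSpace.single i 1) =
        kernelIntegral n α (s + 1) (fun w => (starRingEnd ℂ) (w i) * u w) z := by
  have := isProbabilityMeasure_weightedMeasure (n := n) hα
  have hu' := hu
  obtain ⟨hm, C, hC⟩ := hu
  have hz1 := mem_ball_zero_iff.1 hz
  -- Any radius strictly between |z| and 1 serves: on that ball the derivative of the kernel is
  -- bounded uniformly in w.
  set ρ := (1 + ‖z‖) / 2 with hρ
  have hρ1 : ρ < 1 := by linarith
  have hzρ : ‖z‖ < ρ := by linarith
  set F' : Cn n → Cn n → Cn n →L[ℂ] ℂ := fun z w =>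
    (u w * ((s : ℂ) * (1 - inner ℂ w z : ℂ) ^ (-((s + 1 : ℝ) : ℂ)))) • innerSL ℂ w with hF'
  have hF'm : AEStronglyMeasurable (F' z) (weightedMeasure n α) := by
    refine AEStronglyMeasurable.smul (hm.mul (Measurable.aestronglyMeasurable (by fun_prop))) ?_
    exact (innerSL ℂ (E := Cn n)).continuous.aestronglyMeasurable
  have hbound : ∀ᵐ w ∂(weightedMeasure n α), ∀ x ∈ ball (0 : Cn n) ρ,
      ‖F' x w‖ ≤ C * (s * (1 - ρ) ^ (-(s + 1))) := by
    filter_upwards [hC, ae_weightedMeasure_mem_ball n α] with w hw hb x hx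
    rw [mem_ball_zero_iff] at hb hx
    have hC0 : 0 ≤ C := (norm_nonneg _).trans hw
    have h1 := norm_one_sub_inner_cpow_le hx.le hρ1 hb.le (s := s + 1) (by linarith)
    have h2 : 0 ≤ (1 - ρ) ^ (-(s + 1)) := (norm_nonneg _).trans h1
    simp only [hF']
    rw [norm_smul, norm_mul, norm_mul, Complex.norm_real, Real.norm_of_nonneg hs.le,
      innerSL_apply_norm]
    calc _ ≤ C * (s * (1 - ρ) ^ (-(s + 1))) * 1 := by gcongr
      _ = _ := mul_one _
  have hzmem : z ∈ ball (0 : Cn n) ρ := mem_ball_zero_iff.2 hzρ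
  have hd := hasFDerivAt_integral_of_dominated_of_fderiv_le (𝕜 := ℂ) (μ := weightedMeasure n α)
    (F := fun z w => u w * (1 - inner ℂ w z) ^ (-(s : ℂ))) (F' := F') (x₀ := z)
    (bound := fun _ => C * (s * (1 - ρ) ^ (-(s + 1)))) (s := ball (0 : Cn n) ρ)
    (isOpen_ball.mem_nhds hzmem)
    (Eventually.of_forall fun x => hm.mul (Measurable.aestronglyMeasurable (by fun_prop)))
    (integrable_mul_cpow_smul hα hs hu' hz) hF'm hbound (integrable_const _)
    (by
      filter_upwards [ae_weightedMeasure_mem_ball n α] with w hb x hx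
      rw [mem_ball_zero_iff] at hb hx
      have := (hasFDerivAt_one_sub_inner_cpow (hx.trans hρ1) hb.le s).const_mul (u w)
      simpa only [hF', smul_smul] using this)
  refine ⟨_, hd.const_mul (Real.Gamma s : ℂ), fun i => ?_⟩
  have hi : Integrable (F' z) (weightedMeasure n α) := by
    refine Integrable.of_bound hF'm (C * (s * (1 - ρ) ^ (-(s + 1)))) ?_
    filter_upwards [hbound] with w hw using hw z hzmem
  rw [_root_.smul_apply, ContinuousLinearMap.integral_apply hi, kernelIntegral,
    Real.Gamma_add_one hs.ne', smul_eq_mul, Complex.ofReal_mul, mul_comm (s : ℂ), mul_assoc]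
  congr 1
  rw [← integral_const_mul]
  congr 1
  ext w
  simp only [hF', _root_.smul_apply, innerSL_apply_apply, smul_eq_mul]
  rw [EuclideanSpace.inner_single_right]
  ring

/-- Agreement on the open ball suffices because derivatives depend only on germs; this form of
hypothesis and conclusion can be iterated. -/
theorem partialDeriv_kernelIntegral {n : ℕ} {α s : ℝ} (hα : -1 < α) (hs : 0 < s)
    {u : Cn n → ℂ} (hu : IsEssBounded (weightedMeasure n α) u) {f : Cn n → ℂ} {c : ℂ}
    (hf : Set.EqOn f (fun z => c * kernelIntegral n α s u z) (ball 0 1)) (i : Fin n) :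
    Set.EqOn (partialDeriv i f)
      (fun z => c * kernelIntegral n α (s + 1) (fun w => (starRingEnd ℂ) (w i) * u w) z)
      (ball 0 1) := by
  intro z hz
  obtain ⟨L, hL, hLi⟩ := hasFDerivAt_kernelIntegral hα hs hu hz
  have h : f =ᶠ[𝓝 z] fun z => c * kernelIntegral n α s u z :=
    Filter.eventuallyEq_of_mem (isOpen_ball.mem_nhds hz) hf
  rw [partialDeriv, h.lineDeriv_eq, ((hL.const_mul c).hasLineDerivAt _).lineDeriv]
  simp [hLi]

theorem iterate_partialDeriv_kernelIntegral {n : ℕ} {α s : ℝ} (hα : -1 < α) (hs : 0 < s)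
    {u : Cn n → ℂ} (hu : IsEssBounded (weightedMeasure n α) u) {f : Cn n → ℂ} {c : ℂ}
    (hf : Set.EqOn f (fun z => c * kernelIntegral n α s u z) (ball 0 1)) (i : Fin n) (k : ℕ) :
    IsEssBounded (weightedMeasure n α) (fun w => (starRingEnd ℂ) (w i) ^ k * u w) ∧
    Set.EqOn ((partialDeriv i)^[k] f)
      (fun z => c * kernelIntegral n α (s + k) (fun w => (starRingEnd ℂ) (w i) ^ k * u w) z)
      (ball 0 1) := by
  induction k with
  | zero => simpa using ⟨hu, hf⟩
  | succ k ih =>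
    rw [Function.iterate_succ_apply']
    have h := partialDeriv_kernelIntegral hα (by positivity) ih.1 ih.2 i
    have h' := ih.1.conj_mul i
    simp only [← mul_assoc, ← pow_succ'] at h h'
    push_cast
    rw [← add_assoc]
    exact ⟨h', h⟩

theorem foldr_partialDeriv_kernelIntegral {n : ℕ} {α s : ℝ} (hα : -1 < α) (hs : 0 < s)
    {u : Cn n → ℂ} (hu : IsEssBounded (weightedMeasure n α) u) {f : Cn n → ℂ} {c : ℂ}
    (hf : Set.EqOn f (fun z => c * kernelIntegral n α s u z) (ball 0 1)) (m : Fin n → ℕ)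
    (l : List (Fin n)) :
    IsEssBounded (weightedMeasure n α)
      (fun w => (l.map fun i => (starRingEnd ℂ) (w i) ^ m i).prod * u w) ∧
    Set.EqOn (l.foldr (fun i F => (partialDeriv i)^[m i] F) f)
      (fun z => c * kernelIntegral n α (s + ((l.map m).sum : ℕ))
        (fun w => (l.map fun i => (starRingEnd ℂ) (w i) ^ m i).prod * u w) z) (ball 0 1) := by
  induction l with
  | nil => simpa using ⟨hu, hf⟩
  | cons i l ih =>
    have h := iterate_partialDeriv_kernelIntegral hα (by positivity) ih.1 ih.2 i (m i)
    simp only [List.map_cons, List.prod_cons, List.sum_cons, List.foldr_cons, mul_assoc]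
    rw [add_comm (m i), Nat.cast_add, ← add_assoc]
    exact h

theorem bergmanProjection_eq_kernelIntegral {n : ℕ} {α : ℝ} (hα : -1 < α) (g : Cn n → ℂ)
    (z : Cn n) :
    bergmanProjection n α g z =
      ((Real.Gamma (n + 1 + α) : ℝ) : ℂ)⁻¹ * kernelIntegral n α (n + 1 + α) g z := by
  have hG : ((Real.Gamma (n + 1 + α) : ℝ) : ℂ) ≠ 0 := by
    have : 0 < (n : ℝ) + 1 + α := by linarith [(Nat.cast_nonneg n : (0 : ℝ) ≤ n)]
    exact_mod_cast (Real.Gamma_pos_of_pos this).ne'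
  rw [kernelIntegral, inv_mul_cancel_left₀ hG, bergmanProjection]
  congr 1
  ext w
  rw [kernel, Complex.cpow_neg, one_div, mul_comm]

theorem multiDeriv_bergmanProjection {n : ℕ} {α : ℝ} (hα : -1 < α) {g : Cn n → ℂ}
    (hg : IsEssBounded (weightedMeasure n α) g) (m : Fin n → ℕ) {z : Cn n}
    (hz : z ∈ ball (0 : Cn n) 1) :
    multiDeriv m (bergmanProjection n α g) z =
      ((Real.Gamma (n + 1 + α) : ℝ) : ℂ)⁻¹ * kernelIntegral n α (n + 1 + α + (∑ i, m i : ℕ))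
        (fun w => (∏ i, (starRingEnd ℂ) (w i) ^ m i) * g w) z := by
  have hs : 0 < (n : ℝ) + 1 + α := by linarith [(Nat.cast_nonneg n : (0 : ℝ) ≤ n)]
  have h := (foldr_partialDeriv_kernelIntegral hα hs hg
    (fun z _ => bergmanProjection_eq_kernelIntegral hα g z) m (List.finRange n)).2 hz
  rw [multiDeriv, h]
  simp only [← Fin.sum_univ_def, ← Fin.prod_univ_def]

/-! ### Sharp bounds for the kernel integral -/

theorem lintegral_norm_one_sub_rpow_normalized {s p : ℝ} (hs : 1 < s) (hp : 0 < p) :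
    (discMeasure s Set.univ)⁻¹ * ∫⁻ z, ENNReal.ofReal (‖1 - z‖ ^ (p - s)) ∂(discMeasure s) =
      ENNReal.ofReal (Real.Gamma p * Real.Gamma s / Real.Gamma ((p + s) / 2) ^ 2) := by
  have h1 : 0 < Real.Gamma s := Real.Gamma_pos_of_pos (by linarith)
  have h2 : 0 < Real.Gamma (s - 1) := Real.Gamma_pos_of_pos (by linarith)
  rw [lintegral_norm_one_sub_rpow hp hs, discMeasure_univ hs,
    ← ENNReal.ofReal_inv_of_pos (by positivity), ← ENNReal.ofReal_mul (by positivity)]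
  congr 1
  field_simp

theorem weighted_lintegral_kernel_le {k : ℕ} {α p : ℝ} (hα : -1 < α) (hp : 0 < p)
    {z : Cn (k + 1)} (hz : z ∈ ball (0 : Cn (k + 1)) 1) :
    ENNReal.ofReal ((1 - ‖z‖ ^ 2) ^ p) *
      ∫⁻ w, ENNReal.ofReal (‖1 - inner ℂ w z‖ ^ (-(k + 2 + α + p))) ∂(weightedMeasure (k + 1) α) ≤
    ENNReal.ofReal (Real.Gamma p * Real.Gamma (k + 2 + α) /
      Real.Gamma ((p + (k + 2 + α)) / 2) ^ 2) := by
  have hs : (1 : ℝ) < k + 2 + α := by linarith [(Nat.cast_nonneg k : (0 : ℝ) ≤ k)]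
  rw [mem_ball_zero_iff] at hz
  have hz2 : 0 < 1 - ‖z‖ ^ 2 := by nlinarith [norm_nonneg z]
  rw [lintegral_norm_one_sub_inner_rpow k hα, ← lintegral_norm_one_sub_rpow_normalized hs hp,
    mul_left_comm, ← lintegral_const_mul _ (by fun_prop)]
  refine mul_le_mul_right ?_ _
  have h := lintegral_comp_discInvolution (s := k + 2 + α) (p := p) (norm_nonneg z) hz fun _ => 1
  simp only [mul_one] at h
  refine le_trans (le_of_eq ?_) (lintegral_norm_one_sub_ofReal_mul_le hs hp (norm_nonneg z) hz)
  rw [← h]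
  refine lintegral_congr fun ζ => ?_
  rw [← ENNReal.ofReal_mul (by positivity)]

theorem le_iSup_weighted_lintegral_kernel (k : ℕ) {α p : ℝ} (hα : -1 < α) (hp : 0 < p) (N : ℕ) :
    ENNReal.ofReal (Real.Gamma p * Real.Gamma (k + 2 + α) /
      Real.Gamma ((p + (k + 2 + α)) / 2) ^ 2) ≤
    ⨆ (r : ℝ) (_ : 0 ≤ r ∧ r < 1), ENNReal.ofReal ((1 - r ^ 2) ^ p) *
      ∫⁻ w, ENNReal.ofReal (‖1 - (r : ℂ) * w 0‖ ^ (-(k + 2 + α + p)) * ‖w 0‖ ^ N)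
        ∂(weightedMeasure (k + 1) α) := by
  have hs : (1 : ℝ) < k + 2 + α := by linarith [(Nat.cast_nonneg k : (0 : ℝ) ≤ k)]
  rw [← lintegral_norm_one_sub_rpow_normalized hs hp]
  refine (mul_le_mul_right (lintegral_norm_one_sub_rpow_le_iSup (k + 2 + α) p N) _).trans ?_
  simp_rw [ENNReal.mul_iSup]
  refine iSup₂_mono fun r hr => le_of_eq ?_
  have hr2 : 0 < 1 - r ^ 2 := by nlinarith [hr.1, hr.2]
  rw [lintegral_weightedMeasure_succ k hα
    (f := fun ζ => ENNReal.ofReal (‖1 - (r : ℂ) * ζ‖ ^ (-(k + 2 + α + p)) * ‖ζ‖ ^ N))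
    (by fun_prop), mul_left_comm,
    ← lintegral_comp_discInvolution hr.1 hr.2 fun ζ => ENNReal.ofReal (‖ζ‖ ^ N)]
  congr 1
  rw [← lintegral_const_mul _ (by fun_prop)]
  refine lintegral_congr fun ζ => ?_
  rw [← ENNReal.ofReal_mul (by positivity), ← ENNReal.ofReal_mul (by positivity), mul_assoc]

theorem norm_kernelIntegral_le {k : ℕ} {α p C : ℝ} (hα : -1 < α) (hp : 0 < p) (hC : 0 ≤ C)
    {u : Cn (k + 1) → ℂ} (hu : ∀ᵐ w ∂(weightedMeasure (k + 1) α), ‖u w‖ ≤ C)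
    {z : Cn (k + 1)} (hz : z ∈ ball (0 : Cn (k + 1)) 1) :
    (1 - ‖z‖ ^ 2) ^ p * ‖kernelIntegral (k + 1) α (k + 2 + α + p) u z‖ ≤
      C * (Real.Gamma (k + 2 + α + p) * (Real.Gamma p * Real.Gamma (k + 2 + α) /
        Real.Gamma ((p + (k + 2 + α)) / 2) ^ 2)) := by
  have hs : (1 : ℝ) < k + 2 + α := by linarith [(Nat.cast_nonneg k : (0 : ℝ) ≤ k)]
  have hG : 0 < Real.Gamma (k + 2 + α + p) := Real.Gamma_pos_of_pos (by linarith)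
  have hG1 : 0 < Real.Gamma p := Real.Gamma_pos_of_pos hp
  have hG2 : 0 < Real.Gamma (k + 2 + α) := Real.Gamma_pos_of_pos (by linarith)
  have hz2 : 0 < 1 - ‖z‖ ^ 2 := by
    rw [mem_ball_zero_iff] at hz
    nlinarith [norm_nonneg z]
  have h1 : ‖∫ w, u w * (1 - inner ℂ w z) ^ (-((k + 2 + α + p : ℝ) : ℂ))
      ∂(weightedMeasure (k + 1) α)‖ₑ ≤ ENNReal.ofReal C *
      ∫⁻ w, ENNReal.ofReal (‖1 - inner ℂ w z‖ ^ (-(k + 2 + α + p)))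
        ∂(weightedMeasure (k + 1) α) := by
    rw [← lintegral_const_mul _ (by fun_prop)]
    refine (enorm_integral_le_lintegral_enorm _).trans (lintegral_mono_ae ?_)
    filter_upwards [hu] with w hw
    rw [← ENNReal.ofReal_mul hC, ← ofReal_norm, norm_mul, ← Complex.ofReal_neg,
      Complex.norm_cpow_real]
    exact ENNReal.ofReal_le_ofReal (by gcongr)
  rw [← ENNReal.ofReal_le_ofReal_iff (by positivity), kernelIntegral, norm_mul, Complex.norm_real,
    Real.norm_of_nonneg hG.le, ENNReal.ofReal_mul (by positivity), ENNReal.ofReal_mul hG.le,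
    ENNReal.ofReal_mul hC, ENNReal.ofReal_mul hG.le, ofReal_norm]
  calc _ ≤ ENNReal.ofReal ((1 - ‖z‖ ^ 2) ^ p) * (ENNReal.ofReal (Real.Gamma (k + 2 + α + p)) *
        (ENNReal.ofReal C * ∫⁻ w, ENNReal.ofReal (‖1 - inner ℂ w z‖ ^ (-(k + 2 + α + p)))
        ∂(weightedMeasure (k + 1) α))) := by gcongr
    _ = ENNReal.ofReal C * (ENNReal.ofReal (Real.Gamma (k + 2 + α + p)) *
        (ENNReal.ofReal ((1 - ‖z‖ ^ 2) ^ p) *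
          ∫⁻ w, ENNReal.ofReal (‖1 - inner ℂ w z‖ ^ (-(k + 2 + α + p)))
          ∂(weightedMeasure (k + 1) α))) := by ring
    _ ≤ _ := by
      gcongr
      exact weighted_lintegral_kernel_le hα hp hz

/-! ### The Bloch property and the norm of the projection -/

theorem ae_norm_le_norm {n : ℕ} {α : ℝ} (g : Lp ℂ ∞ (weightedMeasure n α)) :
    ∀ᵐ w ∂(weightedMeasure n α), ‖g w‖ ≤ ‖g‖ := by
  have h := ae_le_eLpNormEssSup (f := g) (μ := weightedMeasure n α)
  filter_upwards [h] with w hw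
  rw [← eLpNorm_exponent_top, ← Lp.enorm_def] at hw
  exact enorm_le_iff_norm_le.1 hw

theorem isEssBounded_coe {n : ℕ} {α : ℝ} (g : Lp ℂ ∞ (weightedMeasure n α)) :
    IsEssBounded (weightedMeasure n α) g :=
  ⟨Lp.aestronglyMeasurable g, _, ae_norm_le_norm g⟩

/-- Each first partial obeys the kernel bound with p = 1, and the Euclidean norm of the gradient is
at most the sum of the moduli of its entries. -/
theorem isBloch_bergmanProjection {k : ℕ} {α : ℝ} (hα : -1 < α)
    (g : Lp ℂ ∞ (weightedMeasure (k + 1) α)) : IsBloch (bergmanProjection (k + 1) α g) := by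
  have hs : 0 < ((k + 1 : ℕ) : ℝ) + 1 + α := by
    push_cast; linarith [(Nat.cast_nonneg k : (0 : ℝ) ≤ k)]
  have hP := bergmanProjection_eq_kernelIntegral (n := k + 1) hα g
  have hg := isEssBounded_coe g
  refine ⟨fun z hz => ?_, ?_⟩
  · obtain ⟨L, hL, -⟩ := hasFDerivAt_kernelIntegral hα hs hg hz
    rw [funext hP]
    exact (hL.const_mul _).differentiableAt.differentiableWithinAt
  · set c : ℂ := ((Real.Gamma ((k + 1 : ℕ) + 1 + α) : ℝ) : ℂ)⁻¹
    set B : ℝ := ‖g‖ * (Real.Gamma (k + 2 + α + 1) * (Real.Gamma 1 * Real.Gamma (k + 2 + α) /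
        Real.Gamma ((1 + (k + 2 + α)) / 2) ^ 2))
    refine ⟨∑ _i : Fin (k + 1), ‖c‖ * B, fun z hz => ?_⟩
    have hz2 : 0 < 1 - ‖z‖ ^ 2 := by
      rw [mem_ball_zero_iff] at hz
      nlinarith [norm_nonneg z]
    have hi : ∀ i, (1 - ‖z‖ ^ 2) * ‖partialDeriv i (bergmanProjection (k + 1) α g) z‖ ≤
        ‖c‖ * B := by
      intro i
      rw [partialDeriv_kernelIntegral hα hs hg (fun z _ => hP z) i hz, norm_mul, mul_left_comm]
      gcongr
      have hu : ∀ᵐ w ∂(weightedMeasure (k + 1) α), ‖(starRingEnd ℂ) (w i) * g w‖ ≤ ‖g‖ := by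
        filter_upwards [ae_norm_le_norm g, ae_weightedMeasure_mem_ball (k + 1) α] with w hw hb
        rw [mem_ball_zero_iff] at hb
        rw [norm_mul, RCLike.norm_conj]
        exact (mul_le_of_le_one_left (norm_nonneg _)
          ((PiLp.norm_apply_le w i).trans hb.le)).trans hw
      have := norm_kernelIntegral_le hα one_pos (norm_nonneg g) hu hz
      rw [Real.rpow_one] at this
      rwa [show ((k + 1 : ℕ) : ℝ) + 1 + α + 1 = k + 2 + α + 1 by push_cast; ring]
    have hn : ‖complexGradient (bergmanProjection (k + 1) α g) z‖ ≤
        ∑ i, ‖partialDeriv i (bergmanProjection (k + 1) α g) z‖ := by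
      rw [EuclideanSpace.norm_eq]
      refine Real.sqrt_le_iff.2 ⟨Finset.sum_nonneg fun i _ => norm_nonneg _, ?_⟩
      exact Finset.sum_sq_le_sq_sum_of_nonneg fun i _ => norm_nonneg _
    calc _ ≤ (1 - ‖z‖ ^ 2) * ∑ i, ‖partialDeriv i (bergmanProjection (k + 1) α g) z‖ := by gcongr
      _ ≤ _ := by
        rw [Finset.mul_sum]
        exact Finset.sum_le_sum fun i _ => hi i

theorem bergmanNorm_le {k : ℕ} {α : ℝ} (hα : -1 < α) {N : ℕ} (hN : 1 ≤ N) :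
    bergmanNorm (k + 1) α N ≤ ENNReal.ofReal (Real.Gamma (k + 2 + α + N) * Real.Gamma N /
      Real.Gamma ((N + (k + 2 + α)) / 2) ^ 2) := by
  have hs : (0 : ℝ) < k + 2 + α := by linarith [(Nat.cast_nonneg k : (0 : ℝ) ≤ k)]
  have hG := Real.Gamma_pos_of_pos hs
  have hN' : (0 : ℝ) < N := by exact_mod_cast hN
  refine iSup₂_le fun g hg1 => iSup₂_le fun m hm => iSup₂_le fun z hz =>
    ENNReal.ofReal_le_ofReal ?_
  have hu : ∀ᵐ w ∂(weightedMeasure (k + 1) α),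
      ‖(∏ i, (starRingEnd ℂ) (w i) ^ m i) * g w‖ ≤ 1 := by
    filter_upwards [ae_norm_le_norm g, ae_weightedMeasure_mem_ball (k + 1) α] with w hw hb
    rw [mem_ball_zero_iff] at hb
    rw [norm_mul, norm_prod]
    refine mul_le_one₀ (Finset.prod_le_one (fun i _ => norm_nonneg _) fun i _ => ?_)
      (norm_nonneg _) (hw.trans hg1)
    rw [norm_pow, RCLike.norm_conj]
    exact pow_le_one₀ (norm_nonneg _) ((PiLp.norm_apply_le w i).trans hb.le)
  have h := norm_kernelIntegral_le hα hN' zero_le_one hu hz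
  have hk : ((k + 1 : ℕ) : ℝ) + 1 + α = k + 2 + α := by push_cast; ring
  rw [multiDeriv_bergmanProjection hα (isEssBounded_coe g) m hz, hm, hk, norm_mul, norm_inv,
    Complex.norm_real, Real.norm_of_nonneg hG.le, mul_left_comm]
  rw [Real.rpow_natCast] at h
  refine (mul_le_mul_of_nonneg_left h (by positivity)).trans (le_of_eq ?_)
  field_simp

theorem le_bergmanNorm {k : ℕ} {α : ℝ} (hα : -1 < α) {N : ℕ} (hN : 1 ≤ N) :
    ENNReal.ofReal (Real.Gamma (k + 2 + α + N) * Real.Gamma N /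
      Real.Gamma ((N + (k + 2 + α)) / 2) ^ 2) ≤ bergmanNorm (k + 1) α N := by
  have hs : (0 : ℝ) < k + 2 + α := by linarith [(Nat.cast_nonneg k : (0 : ℝ) ≤ k)]
  have hG := Real.Gamma_pos_of_pos hs
  have hN' : (0 : ℝ) < N := by exact_mod_cast hN
  have hGN : 0 < Real.Gamma (k + 2 + α + N) := Real.Gamma_pos_of_pos (by linarith)
  have hsplit : Real.Gamma (k + 2 + α + N) * Real.Gamma N /
      Real.Gamma ((N + (k + 2 + α)) / 2) ^ 2 =
      (Real.Gamma (k + 2 + α))⁻¹ * Real.Gamma (k + 2 + α + N) *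
        (Real.Gamma N * Real.Gamma (k + 2 + α) / Real.Gamma ((N + (k + 2 + α)) / 2) ^ 2) := by
    field_simp
  rw [hsplit, ENNReal.ofReal_mul (by positivity)]
  refine (mul_le_mul_right (le_iSup_weighted_lintegral_kernel k hα hN' N) _).trans ?_
  simp_rw [ENNReal.mul_iSup]
  refine iSup₂_le fun r hr => ?_
  have hprob := isProbabilityMeasure_weightedMeasure (n := k + 1) hα
  have hr2 : 0 < 1 - r ^ 2 := by nlinarith [hr.1, hr.2]
  set z : Cn (k + 1) := EuclideanSpace.single 0 (r : ℂ) with hzdef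
  have hznorm : ‖z‖ = r := by simp [hzdef, abs_of_nonneg hr.1]
  have hz : z ∈ ball (0 : Cn (k + 1)) 1 := by rw [mem_ball_zero_iff, hznorm]; exact hr.2
  set m : Fin (k + 1) → ℕ := Pi.single 0 N with hm
  have hmsum : ∑ i, m i = N := by simp [hm]
  set ψ : Cn (k + 1) → ℂ := fun w => (∏ i, (starRingEnd ℂ) (w i) ^ m i) *
    (1 - inner ℂ w z) ^ (-((k + 2 + α + N : ℝ) : ℂ)) with hψ
  have hψm : Measurable ψ := by fun_prop
  have hψn : ∀ w, ‖ψ w‖ = ‖1 - (r : ℂ) * w 0‖ ^ (-(k + 2 + α + N)) * ‖w 0‖ ^ N := by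
    intro w
    simp only [hψ]
    rw [norm_mul, ← Complex.ofReal_neg, Complex.norm_cpow_real, hzdef, norm_one_sub_inner_single,
      mul_comm, Finset.prod_eq_single 0 (fun i _ hi => by simp [hm, hi]) (by simp)]
    simp [hm]
  -- The extremal density makes ψ g₀ = |ψ|; at zeros of ψ the quotient is 0 by convention, which
  -- respects both this identity and the bound by 1.
  set g₀ : Cn (k + 1) → ℂ := fun w => (starRingEnd ℂ) (ψ w) / ‖ψ w‖ with hg₀
  have hg₀m : AEStronglyMeasurable g₀ (weightedMeasure (k + 1) α) :=
    Measurable.aestronglyMeasurable (by fun_prop)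
  have hg₀b : ∀ w, ‖g₀ w‖ ≤ 1 := by
    intro w
    simp only [hg₀]
    rw [norm_div, RCLike.norm_conj, Complex.norm_real, norm_norm]
    exact div_self_le_one _
  have hmem : MemLp g₀ ∞ (weightedMeasure (k + 1) α) :=
    memLp_top_of_bound hg₀m 1 (Eventually.of_forall hg₀b)
  set g := hmem.toLp g₀ with hg
  have hgn : ‖g‖ ≤ 1 := by
    rw [hg, Lp.norm_toLp, eLpNorm_exponent_top]
    refine ENNReal.toReal_le_of_le_ofReal zero_le_one ?_
    exact eLpNormEssSup_le_of_ae_bound (Eventually.of_forall hg₀b)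
  have hint : ∫ w, (∏ i, (starRingEnd ℂ) (w i) ^ m i) * g w *
      (1 - inner ℂ w z) ^ (-((k + 2 + α + N : ℝ) : ℂ)) ∂(weightedMeasure (k + 1) α) =
      ((∫ w, ‖ψ w‖ ∂(weightedMeasure (k + 1) α) : ℝ) : ℂ) := by
    rw [← integral_complex_ofReal]
    refine integral_congr_ae ?_
    filter_upwards [hmem.coeFn_toLp] with w hw
    rw [← hg] at hw
    rw [hw, mul_right_comm]
    change ψ w * g₀ w = _
    simp only [hg₀]
    rw [mul_div_assoc', Complex.mul_conj, Complex.normSq_eq_norm_sq]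
    by_cases h0 : ‖ψ w‖ = 0
    · simp [h0]
    · push_cast
      rw [pow_two, mul_div_assoc, div_self (by exact_mod_cast h0), mul_one]
  have hψint : Integrable ψ (weightedMeasure (k + 1) α) := by
    have hb : IsEssBounded (weightedMeasure (k + 1) α)
        fun w => ∏ i, (starRingEnd ℂ) (w i) ^ m i := by
      -- Only the boundedness half is wanted, with density 1; the values of s, c and f are
      -- placeholders.
      have := (foldr_partialDeriv_kernelIntegral (n := k + 1) (α := α) (s := 1)
        (u := fun _ => 1) (c := 0) (f := fun _ => 0) hα one_pos
        ⟨aestronglyMeasurable_const, 1, by simp⟩ (fun z _ => by simp) m (List.finRange _)).1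
      simpa only [← Fin.prod_univ_def, mul_one] using this
    exact integrable_mul_cpow_smul hα (by linarith) hb hz
  have hk : ((k + 1 : ℕ) : ℝ) + 1 + α = k + 2 + α := by push_cast; ring
  have hval : (1 - ‖z‖ ^ 2) ^ N * ‖multiDeriv m (bergmanProjection (k + 1) α g) z‖ =
      (Real.Gamma (k + 2 + α))⁻¹ * Real.Gamma (k + 2 + α + N) *
        ((1 - r ^ 2) ^ (N : ℝ) * ∫ w, ‖ψ w‖ ∂(weightedMeasure (k + 1) α)) := by
    have hnn : 0 ≤ ∫ w, ‖ψ w‖ ∂(weightedMeasure (k + 1) α) :=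
      integral_nonneg fun _ => norm_nonneg _
    rw [multiDeriv_bergmanProjection hα (isEssBounded_coe g) m hz, hmsum, hk, kernelIntegral, hint,
      norm_mul, norm_mul, norm_inv, Complex.norm_real, Complex.norm_real, Complex.norm_real,
      Real.norm_of_nonneg hG.le, Real.norm_of_nonneg hGN.le, Real.norm_of_nonneg hnn, hznorm,
      Real.rpow_natCast]
    ring
  have hle : ENNReal.ofReal ((1 - ‖z‖ ^ 2) ^ N *
      ‖multiDeriv m (bergmanProjection (k + 1) α g) z‖) ≤ bergmanNorm (k + 1) α N :=
    le_iSup₂_of_le g hgn (le_iSup₂_of_le m hmsum (le_iSup₂_of_le z hz le_rfl))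
  refine le_trans (le_of_eq ?_) hle
  rw [hval, ENNReal.ofReal_mul (by positivity :
      0 ≤ (Real.Gamma (k + 2 + α))⁻¹ * Real.Gamma (k + 2 + α + N)),
    ENNReal.ofReal_mul (by positivity : 0 ≤ (1 - r ^ 2) ^ (N : ℝ)),
    ofReal_integral_norm_eq_lintegral_enorm hψint]
  congr 2
  refine lintegral_congr fun w => ?_
  rw [← hψn, ofReal_norm]

theorem bergmanNorm_eq {n : ℕ} (hn : 1 ≤ n) {α : ℝ} (hα : -1 < α) {N : ℕ} (hN : 1 ≤ N) :
    bergmanNorm n α N =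
      ENNReal.ofReal (Real.Gamma ((n : ℝ) + N + α + 1) * Real.Gamma (N : ℝ) /
        Real.Gamma ((N : ℝ) / 2 + ((n : ℝ) + α + 1) / 2) ^ 2) := by
  obtain ⟨k, rfl⟩ := Nat.exists_eq_add_of_le' hn
  rw [le_antisymm (bergmanNorm_le hα hN) (le_bergmanNorm hα hN)]
  push_cast
  congr 4
  all_goals ring

end BergmanBloch

end

theorem theorem4 (n : ℕ) (hn : 1 ≤ n) (α : ℝ) (hα : -1 < α) (N : ℕ) (hN : 1 ≤ N) :
    (∀ g : Lp ℂ ∞ (BergmanBloch.weightedMeasure n α),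
      BergmanBloch.IsBloch (BergmanBloch.bergmanProjection n α g)) ∧
    BergmanBloch.bergmanNorm n α N =
      ENNReal.ofReal (Real.Gamma ((n : ℝ) + N + α + 1) * Real.Gamma (N : ℝ) /
        Real.Gamma ((N : ℝ) / 2 + ((n : ℝ) + α + 1) / 2) ^ 2) ∧
    BergmanBloch.bergmanNorm n α 1 =
      ENNReal.ofReal (Real.Gamma ((n : ℝ) + α + 2) / Real.Gamma (((n : ℝ) + α + 2) / 2) ^ 2) ∧
    BergmanBloch.bergmanNorm 1 0 1 = ENNReal.ofReal (8 / Real.pi) := by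
  refine ⟨fun g => ?_, BergmanBloch.bergmanNorm_eq hn hα hN, ?_, ?_⟩
  · obtain ⟨k, rfl⟩ := Nat.exists_eq_add_of_le' hn
    exact BergmanBloch.isBloch_bergmanProjection hα g
  · rw [BergmanBloch.bergmanNorm_eq hn hα le_rfl, Nat.cast_one, Real.Gamma_one, mul_one,
      show (n : ℝ) + 1 + α + 1 = n + α + 2 by ring,
      show (1 : ℝ) / 2 + ((n : ℝ) + α + 1) / 2 = ((n : ℝ) + α + 2) / 2 by ring]
  -- Γ(3) = 2 and Γ(3/2)² = π/4.
  · rw [BergmanBloch.bergmanNorm_eq le_rfl (by norm_num) le_rfl, Nat.cast_one, Real.Gamma_one,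
      mul_one, show (1 : ℝ) + 1 + 0 + 1 = (2 : ℕ) + 1 by norm_num, Real.Gamma_nat_eq_factorial,
      show (1 : ℝ) / 2 + (1 + 0 + 1) / 2 = 1 / 2 + 1 by norm_num,
      Real.Gamma_add_one (by norm_num), Real.Gamma_one_half_eq, mul_pow,
      Real.sq_sqrt Real.pi_pos.le]
    congr 1
    norm_num [Nat.factorial]
    field_simp
    norm_num
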